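/- Let $(M,g)$ be a smooth pseudo-Riemannian manifold with Levi-Civita connection $\nabla$, and write $\langle\cdot,\cdot\rangle$ for $g$. For a smooth non-degenerate distribution $E\subseteq TM$ of rank $m$, with splitting $TM=E\oplus E^{\perp}$, put $s^{E}(X,Y)=(\nabla_XY)^{E^{\perp}}$ and $h^{E}(X,Y)=\tfrac12(\nabla_XY+\nabla_YX)^{E^{\perp}}$ for sections $X,Y$ of $E$, and let $H_E=\tfrac1m\operatorname{tr}_g h^{E}$ be the mean curvature normal. Call $E$ \emph{geodesic} if $s^{E}=0$; \emph{umbilical} if $s^{E}(X,Y)=\langle X,Y\rangle H_E$ for all sections $X,Y$ of $E$; \emph{spherical} if it is umbilical and $(\nabla_XH_E)^{E^{\perp}}=0$ for all sections $X$ of $E$; and \emph{Killing} if it is spherical and $E^{\perp}$ is geodesic. Let $T$ be a smooth symmetric tensor field of valence two that is a conformal Killing tensor, i.e. $\nabla_{(i}T_{jk)}=t_{(i}g_{jk)}$ for some smooth vector field $t$. Suppose that the endomorphism field associated with $T$ is pointwise diagonalizable over $\mathbb{R}$, with pointwise distinct eigenfunctions $\lambda_1,\dots,\lambda_k$ whose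 eigenspaces $E_i=\ker(T-\lambda_i I)\neq 0$ are smooth distributions (so that $TM=E_1\oplus\dots\oplus E_k$ is an orthogonal direct sum of non-degenerate distributions). Suppose further that $(E_i)_{i=1}^{k}$ is orthogonally integrable: every point has a neighbourhood diffeomorphic to a product $M_1\times\dots\times M_k$ in such a way that for each $i$ the slices in the direction of $M_i$ are integral manifolds of $E_i$. If, for some $i$, the distribution $E_i^{\perp}$ is geodesic, then $E_i$ is spherical, and hence Killing. -/

import Mathlib

open Bundle FiberBundle VectorField
open scoped Manifold ContDiff

noncomputable section

namespace PseudoRiemannian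

variable {V : Type*} [NormedAddCommGroup V] [NormedSpace ℝ V]
  {M : Type*} [TopologicalSpace M] [ChartedSpace V M]

/-- A smooth pseudo-Riemannian metric on the tangent bundle of `M`: a smooth field of symmetric
non-degenerate bilinear forms (of arbitrary signature). -/
structure Metric (V : Type*) [NormedAddCommGroup V] [NormedSpace ℝ V]
    (M : Type*) [TopologicalSpace M] [ChartedSpace V M] [IsManifold 𝓘(ℝ, V) ∞ M] where
  inner (x : M) : TangentSpace 𝓘(ℝ, V) x →L[ℝ] TangentSpace 𝓘(ℝ, V) x →L[ℝ] ℝ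
  symm (x : M) (v w : TangentSpace 𝓘(ℝ, V) x) : inner x v w = inner x w v
  nondegenerate (x : M) (v : TangentSpace 𝓘(ℝ, V) x) (hv : ∀ w, inner x v w = 0) : v = 0
  contMDiff : ContMDiff 𝓘(ℝ, V) (𝓘(ℝ, V).prod 𝓘(ℝ, V →L[ℝ] V →L[ℝ] ℝ)) ∞
    (fun x ↦ TotalSpace.mk' (V →L[ℝ] V →L[ℝ] ℝ) x (inner x))

/-! ### The Levi-Civita connection -/

section LeviCivita

variable [IsManifold 𝓘(ℝ, V) ∞ M] (g : Metric V M)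

theorem Metric.mdifferentiableAt_inner {X Y : Π x : M, TangentSpace 𝓘(ℝ, V) x} {x : M}
    (hX : MDiffAt (T% X) x) (hY : MDiffAt (T% Y) x) :
    MDiffAt (fun y ↦ g.inner y (X y) (Y y)) x := by
  have : MDifferentiableAt 𝓘(ℝ, V) (𝓘(ℝ, V).prod 𝓘(ℝ))
      (fun m ↦ TotalSpace.mk' ℝ (E := Trivial M ℝ) m (g.inner m (X m) (Y m))) x := by
    apply MDifferentiableAt.clm_bundle_apply₂ (F₁ := V) (F₂ := V)
    · exact g.contMDiff.mdifferentiableAt (by simp)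
    · exact hX
    · exact hY
  simp only [mdifferentiableAt_totalSpace] at this
  exact this.2

/-- Half of the right-hand side of the Koszul formula
`2⟨∇_X Y, Z⟩ = X⟨Y,Z⟩ + Y⟨Z,X⟩ - Z⟨X,Y⟩ + ⟨[X,Y],Z⟩ - ⟨[X,Z],Y⟩ - ⟨[Y,Z],X⟩`. -/
def Metric.koszul (Y X Z : Π x : M, TangentSpace 𝓘(ℝ, V) x) (x : M) : ℝ :=
  (1 / 2 : ℝ) *
    (d% (fun y ↦ g.inner y (Y y) (Z y)) x (X x)
      + d% (fun y ↦ g.inner y (Z y) (X y)) x (Y x)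
      - d% (fun y ↦ g.inner y (X y) (Y y)) x (Z x)
      + g.inner x (mlieBracket 𝓘(ℝ, V) X Y x) (Z x)
      - g.inner x (mlieBracket 𝓘(ℝ, V) X Z x) (Y x)
      - g.inner x (mlieBracket 𝓘(ℝ, V) Y Z x) (X x))

theorem Metric.ext_inner {x : M} {v v' : TangentSpace 𝓘(ℝ, V) x}
    (h : ∀ Z : Π x : M, TangentSpace 𝓘(ℝ, V) x, MDiffAt (T% Z) x →
      g.inner x v (Z x) = g.inner x v' (Z x)) : v = v' := by
  rw [← sub_eq_zero]
  refine g.nondegenerate x _ fun w ↦ ?_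
  have := h (extend V w) (mdifferentiableAt_extend ..)
  simp only [extend_apply_self] at this
  simp [this]

variable [FiniteDimensional ℝ V]

theorem Metric.koszul_tensorial₁ {x : M} {Y Z : Π x : M, TangentSpace 𝓘(ℝ, V) x}
    (hY : MDiffAt (T% Y) x) (hZ : MDiffAt (T% Z) x) :
    TensorialAt 𝓘(ℝ, V) V (fun X ↦ g.koszul Y X Z x) x where
  smul {f X} hf hX := by
    have : CompleteSpace V := FiniteDimensional.complete ℝ V
    have h1 := mvfderiv_fun_mul hf (g.mdifferentiableAt_inner hZ hX)
    have h2 := mvfderiv_fun_mul hf (g.mdifferentiableAt_inner hX hY)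
    simp [Metric.koszul, h1, h2, mlieBracket_smul_left hf hX]
    rw [g.symm x (X x) (Z x), g.symm x (X x) (Y x)]
    ring
  add {X X'} hX hX' := by
    have : CompleteSpace V := FiniteDimensional.complete ℝ V
    have h1 := mvfderiv_fun_add (g.mdifferentiableAt_inner hZ hX) (g.mdifferentiableAt_inner hZ hX')
    have h2 := mvfderiv_fun_add (g.mdifferentiableAt_inner hX hY) (g.mdifferentiableAt_inner hX' hY)
    simp [Metric.koszul, h1, h2, mlieBracket_add_left hX hX']
    ring

theorem Metric.koszul_tensorial₂ {x : M} {Y X : Π x : M, TangentSpace 𝓘(ℝ, V) x}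
    (hY : MDiffAt (T% Y) x) (hX : MDiffAt (T% X) x) :
    TensorialAt 𝓘(ℝ, V) V (fun Z ↦ g.koszul Y X Z x) x where
  smul {f Z} hf hZ := by
    have : CompleteSpace V := FiniteDimensional.complete ℝ V
    have h1 := mvfderiv_fun_mul hf (g.mdifferentiableAt_inner hZ hX)
    have h2 := mvfderiv_fun_mul hf (g.mdifferentiableAt_inner hY hZ)
    simp [Metric.koszul, h1, h2, mlieBracket_smul_right hf hZ]
    rw [g.symm x (Z x) (X x), g.symm x (Z x) (Y x)]
    ring
  add {Z Z'} hZ hZ' := by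
    have : CompleteSpace V := FiniteDimensional.complete ℝ V
    have h1 := mvfderiv_fun_add (g.mdifferentiableAt_inner hZ hX) (g.mdifferentiableAt_inner hZ' hX)
    have h2 := mvfderiv_fun_add (g.mdifferentiableAt_inner hY hZ) (g.mdifferentiableAt_inner hY hZ')
    simp [Metric.koszul, h1, h2, mlieBracket_add_right hZ hZ']
    ring

theorem Metric.koszul_add {x : M} {Y Y' X Z : Π x : M, TangentSpace 𝓘(ℝ, V) x}
    (hY : MDiffAt (T% Y) x) (hY' : MDiffAt (T% Y') x)
    (hX : MDiffAt (T% X) x) (hZ : MDiffAt (T% Z) x) :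
    g.koszul (Y + Y') X Z x = g.koszul Y X Z x + g.koszul Y' X Z x := by
  have : CompleteSpace V := FiniteDimensional.complete ℝ V
  have h1 := mvfderiv_fun_add (g.mdifferentiableAt_inner hY hZ) (g.mdifferentiableAt_inner hY' hZ)
  have h2 := mvfderiv_fun_add (g.mdifferentiableAt_inner hX hY) (g.mdifferentiableAt_inner hX hY')
  simp [Metric.koszul, h1, h2, mlieBracket_add_left hY hY', mlieBracket_add_right hY hY']
  ring

theorem Metric.koszul_smul {x : M} {f : M → ℝ} {Y X Z : Π x : M, TangentSpace 𝓘(ℝ, V) x}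
    (hf : MDiffAt f x) (hY : MDiffAt (T% Y) x)
    (hX : MDiffAt (T% X) x) (hZ : MDiffAt (T% Z) x) :
    g.koszul (f • Y) X Z x = f x * g.koszul Y X Z x + d% f x (X x) * g.inner x (Y x) (Z x) := by
  have : CompleteSpace V := FiniteDimensional.complete ℝ V
  have h1 := mvfderiv_fun_mul hf (g.mdifferentiableAt_inner hY hZ)
  have h2 := mvfderiv_fun_mul hf (g.mdifferentiableAt_inner hX hY)
  simp [Metric.koszul, h1, h2, mlieBracket_smul_left hf hY, mlieBracket_smul_right hf hY]
  rw [g.symm x (X x) (Y x)]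
  ring

/-- The Koszul expression as a bilinear form in `(X x, Z x)`. -/
def Metric.koszulForm {Y : Π x : M, TangentSpace 𝓘(ℝ, V) x} {x : M} (hY : MDiffAt (T% Y) x) :
    TangentSpace 𝓘(ℝ, V) x →L[ℝ] TangentSpace 𝓘(ℝ, V) x →L[ℝ] ℝ :=
  TensorialAt.mkHom₂ (F := V) (F' := V) (I := 𝓘(ℝ, V)) (fun X Z ↦ g.koszul Y X Z x) x
    (fun _ hZ ↦ g.koszul_tensorial₁ hY hZ) (fun _ hX ↦ g.koszul_tensorial₂ hY hX)

theorem Metric.koszulForm_apply {Y X Z : Π x : M, TangentSpace 𝓘(ℝ, V) x} {x : M}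
    (hY : MDiffAt (T% Y) x) (hX : MDiffAt (T% X) x) (hZ : MDiffAt (T% Z) x) :
    g.koszulForm hY (X x) (Z x) = g.koszul Y X Z x :=
  TensorialAt.mkHom₂_apply (F := V) (F' := V) (I := 𝓘(ℝ, V)) _ _ hX hZ

/-- The musical isomorphism `v ↦ ⟨v, ·⟩`. -/
def Metric.flat (x : M) : TangentSpace 𝓘(ℝ, V) x ≃ₗ[ℝ] (TangentSpace 𝓘(ℝ, V) x →L[ℝ] ℝ) :=
  have : FiniteDimensional ℝ (TangentSpace 𝓘(ℝ, V) x) := inferInstanceAs (FiniteDimensional ℝ V)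
  LinearMap.linearEquivOfInjective (g.inner x).toLinearMap
    ((injective_iff_map_eq_zero (g.inner x).toLinearMap).2 fun v hv ↦
      g.nondegenerate x v fun w ↦ congrArg (fun φ ↦ φ w) hv)
    ((Subspace.dual_finrank_eq (K := ℝ) (V := V)).symm.trans
      (LinearMap.toContinuousLinearMap (𝕜 := ℝ) (E := V) (F' := ℝ)).finrank_eq)

theorem Metric.flat_apply (x : M) (v w : TangentSpace 𝓘(ℝ, V) x) :
    g.flat x v w = g.inner x v w := rfl

theorem Metric.inner_flat_symm (x : M) (φ : TangentSpace 𝓘(ℝ, V) x →L[ℝ] ℝ)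
    (w : TangentSpace 𝓘(ℝ, V) x) : g.inner x ((g.flat x).symm φ) w = φ w := by
  rw [← g.flat_apply, LinearEquiv.apply_symm_apply]

open Classical in
/-- The value at `x` of the Levi-Civita derivative `v ↦ ∇_v Y`, given by the Koszul formula
(and `0` by convention where the vector field `Y` is not differentiable). -/
def Metric.leviCivitaAt (Y : Π x : M, TangentSpace 𝓘(ℝ, V) x) (x : M) :
    TangentSpace 𝓘(ℝ, V) x →L[ℝ] TangentSpace 𝓘(ℝ, V) x :=
  have : FiniteDimensional ℝ (TangentSpace 𝓘(ℝ, V) x) := inferInstanceAs (FiniteDimensional ℝ V)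
  have : T2Space (TangentSpace 𝓘(ℝ, V) x) := inferInstanceAs (T2Space V)
  if hY : MDiffAt (T% Y) x then
    LinearMap.toContinuousLinearMap
      ((g.flat x).symm.toLinearMap ∘ₗ (g.koszulForm hY).toLinearMap)
  else 0

theorem Metric.inner_leviCivitaAt {Y X Z : Π x : M, TangentSpace 𝓘(ℝ, V) x} {x : M}
    (hY : MDiffAt (T% Y) x) (hX : MDiffAt (T% X) x) (hZ : MDiffAt (T% Z) x) :
    g.inner x (g.leviCivitaAt Y x (X x)) (Z x) = g.koszul Y X Z x := by
  rw [← g.koszulForm_apply hY hX hZ, Metric.leviCivitaAt, dif_pos hY]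
  exact g.inner_flat_symm x _ _

/-- The Levi-Civita connection of a pseudo-Riemannian metric; `g.leviCivita Y x v` is
`(∇_v Y)(x)`. -/
def Metric.leviCivita : CovariantDerivative 𝓘(ℝ, V) V (TangentSpace 𝓘(ℝ, V) : M → Type _) where
  toFun := g.leviCivitaAt
  isCovariantDerivativeOnUniv :=
    { add := by
        intro Y Y' x hY hY' _
        ext v
        refine g.ext_inner fun Z hZ ↦ ?_
        have hX : MDiffAt (T% (extend V v)) x := mdifferentiableAt_extend ..
        have h0 := g.inner_leviCivitaAt (mdifferentiableAt_add_section hY hY') hX hZ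
        have h1 := g.inner_leviCivitaAt hY hX hZ
        have h2 := g.inner_leviCivitaAt hY' hX hZ
        simp only [extend_apply_self] at h0 h1 h2
        simp [h0, h1, h2, g.koszul_add hY hY' hX hZ]
      leibniz := by
        intro Y f x hY hf _
        ext v
        refine g.ext_inner fun Z hZ ↦ ?_
        have hX : MDiffAt (T% (extend V v)) x := mdifferentiableAt_extend ..
        have h0 := g.inner_leviCivitaAt (hf.smul_section hY) hX hZ
        have h1 := g.inner_leviCivitaAt hY hX hZ
        simp only [extend_apply_self] at h0 h1
        have h2 := g.koszul_smul hf hY hX hZ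
        simp only [extend_apply_self] at h2
        simp [h0, h1, h2] }

/-- The Levi-Civita connection is torsion-free. -/
theorem Metric.leviCivita_torsion {X Y : Π x : M, TangentSpace 𝓘(ℝ, V) x} {x : M}
    (hX : MDiffAt (T% X) x) (hY : MDiffAt (T% Y) x) :
    g.leviCivita Y x (X x) - g.leviCivita X x (Y x) = mlieBracket 𝓘(ℝ, V) X Y x := by
  refine g.ext_inner fun Z hZ ↦ ?_
  have h1 := g.inner_leviCivitaAt hY hX hZ
  have h2 := g.inner_leviCivitaAt hX hY hZ
  change g.inner x (g.leviCivitaAt Y x (X x) - g.leviCivitaAt X x (Y x)) (Z x) = _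
  simp only [map_sub, sub_apply, h1, h2, Metric.koszul]
  rw [mlieBracket_swap_apply (V := Y) (W := X),
    (funext fun y ↦ g.symm y (X y) (Z y) :
      (fun y ↦ g.inner y (X y) (Z y)) = fun y ↦ g.inner y (Z y) (X y)),
    (funext fun y ↦ g.symm y (Y y) (Z y) :
      (fun y ↦ g.inner y (Y y) (Z y)) = fun y ↦ g.inner y (Z y) (Y y)),
    (funext fun y ↦ g.symm y (Y y) (X y) :
      (fun y ↦ g.inner y (Y y) (X y)) = fun y ↦ g.inner y (X y) (Y y))]
  simp
  ring

/-- The Levi-Civita connection is compatible with the metric. -/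
theorem Metric.leviCivita_metric {X Y Z : Π x : M, TangentSpace 𝓘(ℝ, V) x} {x : M}
    (hX : MDiffAt (T% X) x) (hY : MDiffAt (T% Y) x) (hZ : MDiffAt (T% Z) x) :
    d% (fun y ↦ g.inner y (Y y) (Z y)) x (X x) =
      g.inner x (g.leviCivita Y x (X x)) (Z x) + g.inner x (Y x) (g.leviCivita Z x (X x)) := by
  have h1 := g.inner_leviCivitaAt hY hX hZ
  have h2 := g.inner_leviCivitaAt hZ hX hY
  rw [g.symm x (Y x)]
  change _ = g.inner x (g.leviCivitaAt Y x (X x)) (Z x) + g.inner x (g.leviCivitaAt Z x (X x)) (Y x)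
  rw [h1, h2, Metric.koszul, Metric.koszul, mlieBracket_swap_apply (V := Z) (W := Y)]
  rw [(funext fun y ↦ g.symm y (Z y) (Y y) :
      (fun y ↦ g.inner y (Z y) (Y y)) = fun y ↦ g.inner y (Y y) (Z y)),
    (funext fun y ↦ g.symm y (Z y) (X y) :
      (fun y ↦ g.inner y (Z y) (X y)) = fun y ↦ g.inner y (X y) (Z y)),
    (funext fun y ↦ g.symm y (Y y) (X y) :
      (fun y ↦ g.inner y (Y y) (X y)) = fun y ↦ g.inner y (X y) (Y y))]
  simp
  ring

end LeviCivita

/-! ### Distributions -/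

/-- A field of tangent subspaces. -/
abbrev Distribution (V : Type*) [NormedAddCommGroup V] [NormedSpace ℝ V]
    (M : Type*) [TopologicalSpace M] [ChartedSpace V M] :=
  Π x : M, Submodule ℝ (TangentSpace 𝓘(ℝ, V) x)

section Geometry

variable [IsManifold 𝓘(ℝ, V) ∞ M]

/-- `E` is a smooth subbundle of the tangent bundle: it has a smooth frame near every point. -/
def Distribution.IsSmooth (E : Distribution V M) : Prop :=
  ∀ p : M, ∃ U : Set M, IsOpen U ∧ p ∈ U ∧
    ∃ (m : ℕ) (s : Fin m → Π x : M, TangentSpace 𝓘(ℝ, V) x),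
      (∀ a, CMDiff[U] ∞ (T% (s a))) ∧
      ∀ q ∈ U, LinearIndependent ℝ (fun a ↦ s a q) ∧
        Submodule.span ℝ (Set.range fun a ↦ s a q) = E q

/-- `X` is a smooth section of `E` over `U`. -/
structure Distribution.IsSectionOn (E : Distribution V M) (U : Set M)
    (X : Π x : M, TangentSpace 𝓘(ℝ, V) x) : Prop where
  smooth : CMDiff[U] ∞ (T% X)
  mem : ∀ x ∈ U, X x ∈ E x

variable (g : Metric V M)

/-- The orthogonal complement `E^⊥`. -/
def Metric.perp (E : Distribution V M) : Distribution V M := fun x ↦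
  { carrier := {w | ∀ v ∈ E x, g.inner x v w = 0}
    add_mem' := fun ha hb v hv ↦ by simp [ha v hv, hb v hv]
    zero_mem' := fun v _ ↦ by simp
    smul_mem' := fun c a ha v hv ↦ by simp [ha v hv] }

/-- The induced metric on `E` is non-degenerate at every point. -/
def Metric.IsNondegenerate (E : Distribution V M) : Prop :=
  ∀ x, ∀ v ∈ E x, (∀ w ∈ E x, g.inner x v w = 0) → v = 0

open Classical in
/-- The component `v^E` of `v` in the splitting `TM = E ⊕ E^⊥`, which exists when `E` is
non-degenerate (and `0` by convention when there is no such splitting). -/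
def Metric.tangentPart (E : Distribution V M) (x : M) :
    TangentSpace 𝓘(ℝ, V) x →ₗ[ℝ] TangentSpace 𝓘(ℝ, V) x :=
  if h : IsCompl (E x) (g.perp E x) then (E x).projection (g.perp E x) h else 0

/-- The component `v^{E^⊥} = v - v^E`. -/
def Metric.normalPart (E : Distribution V M) (x : M) :
    TangentSpace 𝓘(ℝ, V) x →ₗ[ℝ] TangentSpace 𝓘(ℝ, V) x :=
  LinearMap.id - g.tangentPart E x

variable [FiniteDimensional ℝ V]

/-- The generalized second fundamental form `s^E(X, Y) = (∇_X Y)^{E^⊥}`. -/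
def Metric.genSecondForm (E : Distribution V M) (X Y : Π x : M, TangentSpace 𝓘(ℝ, V) x) (x : M) :
    TangentSpace 𝓘(ℝ, V) x :=
  g.normalPart E x (g.leviCivita Y x (X x))

/-- The second fundamental form `h^E(X, Y) = (∇_X Y + ∇_Y X)^{E^⊥} / 2`. -/
def Metric.secondForm (E : Distribution V M) (X Y : Π x : M, TangentSpace 𝓘(ℝ, V) x) (x : M) :
    TangentSpace 𝓘(ℝ, V) x :=
  (1 / 2 : ℝ) • g.normalPart E x (g.leviCivita Y x (X x) + g.leviCivita X x (Y x))

/-- A section of `E` near `x` that extends the vector `v ∈ E x`. -/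
def Metric.sectionThrough (E : Distribution V M) {x : M} (v : E x) :
    Π y : M, TangentSpace 𝓘(ℝ, V) y :=
  fun y ↦ g.tangentPart E y (extend V (v : TangentSpace 𝓘(ℝ, V) x) y)

/-- The mean curvature normal `H_E = (1/m) tr h^E`, where `m` is the rank of `E`. The metric trace
`∑ g^{ab} h^E(e_a, e_b)` is taken in a basis `e` of `E x`, with `(g^{ab})` the inverse of the Gram
matrix of `e`; neither the basis nor the extension of its vectors to sections of `E` matters. -/
def Metric.meanCurvature (E : Distribution V M) (x : M) : TangentSpace 𝓘(ℝ, V) x :=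
  have : FiniteDimensional ℝ (TangentSpace 𝓘(ℝ, V) x) := inferInstanceAs (FiniteDimensional ℝ V)
  let m := Module.finrank ℝ (E x)
  let e : Module.Basis (Fin m) ℝ (E x) := Module.finBasis ℝ (E x)
  let gram : Matrix (Fin m) (Fin m) ℝ := Matrix.of fun a b ↦ g.inner x (e a) (e b)
  (1 / m : ℝ) • ∑ a, ∑ b,
    gram⁻¹ a b • g.secondForm E (g.sectionThrough E (e a)) (g.sectionThrough E (e b)) x

/-- `E` is geodesic: `s^E = 0`. -/
def Metric.IsGeodesic (E : Distribution V M) : Prop :=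
  ∀ (U : Set M) (X Y : Π x : M, TangentSpace 𝓘(ℝ, V) x), IsOpen U →
    E.IsSectionOn U X → E.IsSectionOn U Y → ∀ x ∈ U, g.genSecondForm E X Y x = 0

/-- `E` is umbilical: `s^E(X, Y) = ⟨X, Y⟩ H_E`. -/
def Metric.IsUmbilical (E : Distribution V M) : Prop :=
  ∀ (U : Set M) (X Y : Π x : M, TangentSpace 𝓘(ℝ, V) x), IsOpen U →
    E.IsSectionOn U X → E.IsSectionOn U Y →
    ∀ x ∈ U, g.genSecondForm E X Y x = g.inner x (X x) (Y x) • g.meanCurvature E x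

/-- `E` is spherical: it is umbilical and `∇^{E^⊥}_X H_E = (∇_X H_E)^{E^⊥} = 0` for all
sections `X` of `E`. The mean curvature normal of a smooth non-degenerate distribution is
automatically smooth; this is recorded so that the derivative is visibly meaningful. -/
structure Metric.IsSpherical (E : Distribution V M) : Prop where
  umbilical : g.IsUmbilical E
  smooth_meanCurvature : CMDiff ∞ (T% (g.meanCurvature E))
  parallel : ∀ (U : Set M) (X : Π x : M, TangentSpace 𝓘(ℝ, V) x), IsOpen U →
    E.IsSectionOn U X →
    ∀ x ∈ U, g.normalPart E x (g.leviCivita (g.meanCurvature E) x (X x)) = 0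

/-- `E` is Killing: it is spherical and its orthogonal complement is geodesic. -/
structure Metric.IsKilling (E : Distribution V M) : Prop where
  spherical : g.IsSpherical E
  perp_geodesic : g.IsGeodesic (g.perp E)

/-! ### Conformal Killing tensors -/

/-- A smooth symmetric tensor field of valence two, given as the field of `g`-self-adjoint
endomorphisms obtained from it by raising or lowering an index. -/
structure Metric.IsSymmetricTensor
    (T : Π x : M, TangentSpace 𝓘(ℝ, V) x →L[ℝ] TangentSpace 𝓘(ℝ, V) x) : Prop where
  smooth : ContMDiff 𝓘(ℝ, V) (𝓘(ℝ, V).prod 𝓘(ℝ, V →L[ℝ] V)) ∞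
    (fun x ↦ TotalSpace.mk' (V →L[ℝ] V) x (T x))
  symm : ∀ x v w, g.inner x (T x v) w = g.inner x v (T x w)

/-- `⟨(∇_X T) Y, Z⟩`, that is `(∇_X T)(Y, Z)` for the tensor with both indices lowered. -/
def Metric.covDerivTensor (T : Π x : M, TangentSpace 𝓘(ℝ, V) x →L[ℝ] TangentSpace 𝓘(ℝ, V) x)
    (X Y Z : Π x : M, TangentSpace 𝓘(ℝ, V) x) (x : M) : ℝ :=
  g.inner x (g.leviCivita (fun y ↦ T y (Y y)) x (X x) - T x (g.leviCivita Y x (X x))) (Z x)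

/-- `T` is a conformal Killing tensor: for some smooth vector field `t`, the conformal factor,
`∇_{(i} T_{jk)} = t_{(i} g_{jk)}`. -/
structure Metric.IsConformalKilling
    (T : Π x : M, TangentSpace 𝓘(ℝ, V) x →L[ℝ] TangentSpace 𝓘(ℝ, V) x) : Prop where
  symmetricTensor : g.IsSymmetricTensor T
  exists_conformalFactor : ∃ t : Π x : M, TangentSpace 𝓘(ℝ, V) x, CMDiff ∞ (T% t) ∧
    ∀ (U : Set M) (X Y Z : Π x : M, TangentSpace 𝓘(ℝ, V) x), IsOpen U →
      CMDiff[U] ∞ (T% X) → CMDiff[U] ∞ (T% Y) → CMDiff[U] ∞ (T% Z) → ∀ x ∈ U,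
        g.covDerivTensor T X Y Z x + g.covDerivTensor T Y Z X x + g.covDerivTensor T Z X Y x =
          g.inner x (t x) (X x) * g.inner x (Y x) (Z x)
            + g.inner x (t x) (Y x) * g.inner x (Z x) (X x)
            + g.inner x (t x) (Z x) * g.inner x (X x) (Y x)

/-! ### Nets -/

/-- `M` is locally a product adapted to `(E_i)`: near every point there is a diffeomorphism onto a
product `∏ S_i` of manifolds (which may be taken to be open sets of Euclidean spaces) that turns
the slices in the direction of the `i`-th factor into integral manifolds of `E_i`. -/
def IsLocallyDecomposable {k : ℕ} (E : Fin k → Distribution V M) : Prop :=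
  ∀ p : M, ∃ (m : Fin k → ℕ)
    (φ : OpenPartialHomeomorph M (Π i, EuclideanSpace ℝ (Fin (m i))))
    (S : Π i, Set (EuclideanSpace ℝ (Fin (m i)))),
    p ∈ φ.source ∧
    ContMDiffOn 𝓘(ℝ, V) 𝓘(ℝ, Π i, EuclideanSpace ℝ (Fin (m i))) ∞ φ φ.source ∧
    ContMDiffOn 𝓘(ℝ, Π i, EuclideanSpace ℝ (Fin (m i))) 𝓘(ℝ, V) ∞ φ.symm φ.target ∧
    (∀ i, IsOpen (S i)) ∧ φ.target = Set.univ.pi S ∧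
    ∀ q ∈ φ.source, ∀ (i : Fin k) (v : TangentSpace 𝓘(ℝ, V) q), v ∈ E i q ↔
      ∀ j, j ≠ i →
        (mfderiv 𝓘(ℝ, V) 𝓘(ℝ, Π i, EuclideanSpace ℝ (Fin (m i))) φ q v :
          Π i, EuclideanSpace ℝ (Fin (m i))) j = 0

/-- `(E_i)` is orthogonally integrable: it is a net of smooth non-degenerate distributions that
split `TM` as an orthogonal direct sum and are the tangent distributions of a local product
structure. In particular each `E_i` is integrable. -/
structure Metric.IsOrthogonallyIntegrable {k : ℕ} (E : Fin k → Distribution V M) : Prop where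
  smooth : ∀ i, (E i).IsSmooth
  nondegenerate : ∀ i, g.IsNondegenerate (E i)
  orthogonal : ∀ i j, i ≠ j → ∀ x, ∀ v ∈ E i x, ∀ w ∈ E j x, g.inner x v w = 0
  directSum : ∀ x, DirectSum.IsInternal fun i ↦ E i x
  decomposable : IsLocallyDecomposable E

/-- `(E_i)` is the net of eigenspaces of the conformal Killing tensor `T`, with eigenfunctions
`lam i`, and it is orthogonally integrable. As the `E_i` split `TM`, `T` is pointwise
diagonalizable and the `lam i x` are all its eigenvalues at `x`. -/
structure Metric.IsConformalKillingNet {k : ℕ}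
    (T : Π x : M, TangentSpace 𝓘(ℝ, V) x →L[ℝ] TangentSpace 𝓘(ℝ, V) x)
    (lam : Fin k → M → ℝ) (E : Fin k → Distribution V M) : Prop where
  conformalKilling : g.IsConformalKilling T
  distinct : ∀ i j, i ≠ j → ∀ x, lam i x ≠ lam j x
  mem_iff : ∀ i x v, v ∈ E i x ↔ T x v = lam i x • v
  ne_bot : ∀ i x, E i x ≠ ⊥
  orthogonallyIntegrable : g.IsOrthogonallyIntegrable E

end Geometry

end PseudoRiemannian

end

/-! Everything comes from evaluating the conformal Killing equation on eigenvector fields. With `X`,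
`Y` in `E_i` and `Z` in `E_j`, `j ≠ i`, integrability of `E_i` makes two of the three terms equal,
giving `2(λ_i - λ_j)⟨∇_X Y, Z⟩ = (⟨t, Z⟩ - dλ_i(Z))⟨X, Y⟩` (`inner_leviCivita_eq`); hence `E_i` is
umbilical. With all three fields in `E_j` it gives `dλ_j = ⟨t, ·⟩` on `E_j`
(`mvfderiv_eigenfunction_self`), so the `E_j`-part of `H = H_{E_i}` is that of `-½ grad log |λ_i -
λ_j|`.

If `E_i^⊥` is geodesic, the same identity with `i` and `j` exchanged gives `dλ_j = ⟨t, ·⟩` on `E_i`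
for every `j`, so `μ = λ_i - λ_j` is constant along `E_i`. Apply `[X, Z]` to `μ`: since `[X, Z]`
lies in `E_i ⊕ E_j`, this yields `X⟨H, Z⟩ = ⟨H, [X, Z]⟩` (`mvfderiv_inner_meanCurvature`). Therefore
`⟨∇_X H, Z⟩ = -⟨H, ∇_Z X⟩ = ⟨∇_Z H, X⟩`, which vanishes because `Z` and `H` are sections of the
geodesic distribution `E_i^⊥`. -/

namespace PseudoRiemannian

/-! ### Smooth functions and vector fields; the bracket as a commutator. -/

section Calculus

variable {V : Type*} [NormedAddCommGroup V] [NormedSpace ℝ V]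
  {M : Type*} [TopologicalSpace M] [ChartedSpace V M] [IsManifold 𝓘(ℝ, V) ∞ M]
  {x : M}

omit [IsManifold 𝓘(ℝ, V) ∞ M] in
theorem eventually_mdifferentiableAt [IsManifold 𝓘(ℝ, V) 1 M] {F H N : Type*}
    [NormedAddCommGroup F] [NormedSpace ℝ F] [TopologicalSpace H] {J : ModelWithCorners ℝ F H}
    [TopologicalSpace N] [ChartedSpace H N] [IsManifold J 1 N] {f : M → N}
    (hf : ContMDiffAt 𝓘(ℝ, V) J ∞ f x) : ∀ᶠ y in nhds x, MDifferentiableAt 𝓘(ℝ, V) J f y :=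
  ((contMDiffAt_iff_contMDiffAt_nhds (n := 1) (by simp)).1 (hf.of_le ENat.LEInfty.out)).mono
    fun _ h ↦ h.mdifferentiableAt one_ne_zero

/-- The derivative of a smooth function along a smooth vector field is smooth. -/
theorem contMDiffAt_mvfderiv_apply {f : M → ℝ} {X : Π x : M, TangentSpace 𝓘(ℝ, V) x}
    (hf : CMDiffAt ∞ f x) (hX : CMDiffAt ∞ (T% X) x) :
    CMDiffAt ∞ (fun y ↦ d% f y (X y)) x := by
  have h1 := hf.mfderiv_const (m := ∞) (by simp)
  have h2 := ContMDiffAt.clm_apply_of_inCoordinates (n := ∞) (F₁ := V) (F₂ := ℝ)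
    (E₁ := (TangentSpace 𝓘(ℝ, V) : M → Type _)) (E₂ := (TangentSpace 𝓘(ℝ, ℝ) : ℝ → Type _))
    (b₁ := id) (b₂ := f) (ϕ := fun y ↦ mfderiv 𝓘(ℝ, V) 𝓘(ℝ, ℝ) f y) (v := X) h1 hX hf
  rw [contMDiffAt_totalSpace] at h2
  exact h2.2.congr_of_eventuallyEq (Filter.Eventually.of_forall fun y ↦ by
    simp [mvfderiv]; rfl)

theorem contMDiffAt_mlieBracket [CompleteSpace V] {X Y : Π x : M, TangentSpace 𝓘(ℝ, V) x}
    (hX : CMDiffAt ∞ (T% X) x) (hY : CMDiffAt ∞ (T% Y) x) :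
    CMDiffAt ∞ (T% (mlieBracket 𝓘(ℝ, V) X Y)) x := by
  have : IsManifold 𝓘(ℝ, V) (((⊤ : ℕ∞) : WithTop ℕ∞) + 1) M := by simpa
  have : IsManifold 𝓘(ℝ, V) (minSmoothness ℝ 2) M := by
    rw [minSmoothness_of_isRCLikeNormedField]; infer_instance
  have : IsManifold 𝓘(ℝ, V) (minSmoothness ℝ 3) M := by
    rw [minSmoothness_of_isRCLikeNormedField]; exact IsManifold.of_le (n := ∞) ENat.LEInfty.out
  exact ContMDiffAt.mlieBracket_vectorField (m := ⊤) (n := ⊤) hX hY (by simp)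

/-- The Lie bracket acts on functions as the commutator of derivations. -/
theorem mvfderiv_mlieBracket_apply [CompleteSpace V] {f : M → ℝ}
    {X Y : Π x : M, TangentSpace 𝓘(ℝ, V) x}
    (hf : CMDiffAt ∞ f x) (hX : CMDiffAt ∞ (T% X) x) (hY : CMDiffAt ∞ (T% Y) x) :
    d% f x (mlieBracket 𝓘(ℝ, V) X Y x) =
      d% (fun y ↦ d% f y (Y y)) x (X x) - d% (fun y ↦ d% f y (X y)) x (Y x) := by
  have : IsManifold 𝓘(ℝ, V) (minSmoothness ℝ 3) M := by
    rw [minSmoothness_of_isRCLikeNormedField]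
    exact IsManifold.of_le (n := ∞) ENat.LEInfty.out
  by_cases hV : ∃ z : V, z ≠ 0
  swap
  · have h0 : ∀ w : TangentSpace 𝓘(ℝ, V) x, w = 0 := by
      push Not at hV
      exact hV
    rw [h0 (mlieBracket 𝓘(ℝ, V) X Y x), h0 (X x), h0 (Y x)]
    simp
  obtain ⟨z, hz⟩ := hV
  set Z : Π x : M, TangentSpace 𝓘(ℝ, V) x := extend V (z : TangentSpace 𝓘(ℝ, V) x)
  have hZx : Z x = z := extend_apply_self ..
  have hZ : CMDiffAt ∞ (T% Z) x := contMDiffAt_extend ..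
  have hle : (minSmoothness ℝ 2) ≤ ((⊤ : ℕ∞) : WithTop ℕ∞) := by
    rw [minSmoothness_of_isRCLikeNormedField]; exact ENat.LEInfty.out
  have hfZ : CMDiffAt ∞ (T% (f • Z)) x := hf.smul_section hZ
  -- The Jacobi identity for `X, Y, fZ` minus `f` times the one for `X, Y, Z` leaves `([X,Y]f -
  -- X(Yf) + Y(Xf)) Z = 0`. As `Z x ≠ 0`, the coefficient vanishes.
  have key := leibniz_identity_mlieBracket_apply (hX.of_le hle) (hY.of_le hle) (hfZ.of_le hle)
  have key0 := leibniz_identity_mlieBracket_apply (hX.of_le hle) (hY.of_le hle) (hZ.of_le hle)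
  have hev (W : Π x : M, TangentSpace 𝓘(ℝ, V) x) :
      mlieBracket 𝓘(ℝ, V) W (f • Z) =ᶠ[nhds x]
        ((fun y ↦ d% f y (W y)) • Z + f • mlieBracket 𝓘(ℝ, V) W Z) := by
    filter_upwards [eventually_mdifferentiableAt hf, eventually_mdifferentiableAt hZ] with y h1 h2
    exact mlieBracket_smul_right h1 h2
  have md {W : Π x : M, TangentSpace 𝓘(ℝ, V) x} (h : CMDiffAt ∞ (T% W) x) : MDiffAt (T% W) x :=
    h.mdifferentiableAt (by simp)
  have mf {W : M → ℝ} (h : CMDiffAt ∞ W x) : MDiffAt W x :=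
    h.mdifferentiableAt (by simp)
  have hXY := contMDiffAt_mlieBracket hX hY
  have hXZ := contMDiffAt_mlieBracket hX hZ
  have hYZ := contMDiffAt_mlieBracket hY hZ
  have hXf := contMDiffAt_mvfderiv_apply hf hX
  have hYf := contMDiffAt_mvfderiv_apply hf hY
  rw [(Filter.EventuallyEq.refl _ X).mlieBracket_vectorField_eq (hev Y),
    (Filter.EventuallyEq.refl _ Y).mlieBracket_vectorField_eq (hev X),
    mlieBracket_smul_right (mf hf) (md hZ),
    mlieBracket_add_right (md (hYf.smul_section hZ)) (md (hf.smul_section hYZ)),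
    mlieBracket_add_right (md (hXf.smul_section hZ)) (md (hf.smul_section hXZ)),
    mlieBracket_smul_right (mf hYf) (md hZ), mlieBracket_smul_right (mf hf) (md hYZ),
    mlieBracket_smul_right (mf hXf) (md hZ), mlieBracket_smul_right (mf hf) (md hXZ),
    key0] at key
  have h3 : (d% f x (mlieBracket 𝓘(ℝ, V) X Y x) -
      (d% (fun y ↦ d% f y (Y y)) x (X x) - d% (fun y ↦ d% f y (X y)) x (Y x))) • Z x = 0 := by
    rw [← sub_eq_zero] at key
    rw [← neg_eq_zero, ← key]
    module
  rw [hZx] at h3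
  exact sub_eq_zero.1 ((smul_eq_zero.1 h3).resolve_right hz)

end Calculus

/-! ### Smoothness of inner products, Koszul expressions and inverse matrices. -/

section MetricCalculus

variable {V : Type*} [NormedAddCommGroup V] [NormedSpace ℝ V]
  {M : Type*} [TopologicalSpace M] [ChartedSpace V M] [IsManifold 𝓘(ℝ, V) ∞ M]
  (g : Metric V M) {x : M}

theorem Metric.contMDiffAt_inner {X Y : Π x : M, TangentSpace 𝓘(ℝ, V) x}
    (hX : CMDiffAt ∞ (T% X) x) (hY : CMDiffAt ∞ (T% Y) x) :
    CMDiffAt ∞ (fun y ↦ g.inner y (X y) (Y y)) x := by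
  have : ContMDiffAt 𝓘(ℝ, V) (𝓘(ℝ, V).prod 𝓘(ℝ)) ∞
      (fun m ↦ TotalSpace.mk' ℝ (E := Trivial M ℝ) m (g.inner m (X m) (Y m))) x := by
    apply ContMDiffAt.clm_bundle_apply₂ (F₁ := V) (F₂ := V)
    · exact g.contMDiff x
    · exact hX
    · exact hY
  rw [contMDiffAt_totalSpace] at this
  exact this.2

theorem Metric.contMDiffAt_koszul [FiniteDimensional ℝ V] {X Y Z : Π x : M, TangentSpace 𝓘(ℝ, V) x}
    (hX : CMDiffAt ∞ (T% X) x) (hY : CMDiffAt ∞ (T% Y) x) (hZ : CMDiffAt ∞ (T% Z) x) :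
    CMDiffAt ∞ (g.koszul Y X Z) x := by
  have : CompleteSpace V := FiniteDimensional.complete ℝ V
  have h1 := contMDiffAt_mvfderiv_apply (g.contMDiffAt_inner hY hZ) hX
  have h2 := contMDiffAt_mvfderiv_apply (g.contMDiffAt_inner hZ hX) hY
  have h3 := contMDiffAt_mvfderiv_apply (g.contMDiffAt_inner hX hY) hZ
  have h4 := g.contMDiffAt_inner (contMDiffAt_mlieBracket hX hY) hZ
  have h5 := g.contMDiffAt_inner (contMDiffAt_mlieBracket hX hZ) hY
  have h6 := g.contMDiffAt_inner (contMDiffAt_mlieBracket hY hZ) hX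
  exact contMDiffAt_const.mul (((((h1.add h2).sub h3).add h4).sub h5).sub h6)

omit [IsManifold 𝓘(ℝ, V) ∞ M] in
theorem contMDiffAt_matrix_det {ι : Type*} [Fintype ι] [DecidableEq ι] {A : M → Matrix ι ι ℝ}
    (hA : ∀ a b, CMDiffAt ∞ (fun y ↦ A y a b) x) : CMDiffAt ∞ (fun y ↦ (A y).det) x := by
  simp only [Matrix.det_apply']
  refine contMDiffAt_finsetSum fun σ _ ↦ contMDiffAt_const.mul ?_
  exact contMDiffAt_finsetProd fun a _ ↦ hA _ _

omit [IsManifold 𝓘(ℝ, V) ∞ M] in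
theorem contMDiffAt_matrix_inv_apply {ι : Type*} [Fintype ι] [DecidableEq ι]
    {A : M → Matrix ι ι ℝ} (hA : ∀ a b, CMDiffAt ∞ (fun y ↦ A y a b) x) (h0 : (A x).det ≠ 0)
    (a b : ι) : CMDiffAt ∞ (fun y ↦ (A y)⁻¹ a b) x := by
  -- Cramer's rule: an entry of the adjugate is the determinant of `A` with one row replaced by a
  -- constant basis vector.
  have h1 : CMDiffAt ∞ (fun y ↦ (A y).det⁻¹ * (A y).adjugate a b) x := by
    refine ContMDiffAt.mul ((contMDiffAt_matrix_det hA).inv₀ h0) ?_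
    simp only [Matrix.adjugate_apply]
    refine contMDiffAt_matrix_det fun c d ↦ ?_
    by_cases h : c = b
    · subst h; simpa using contMDiffAt_const
    · simpa [Matrix.updateRow_ne h] using hA c d
  refine h1.congr_of_eventuallyEq (Filter.Eventually.of_forall fun y ↦ ?_)
  simp [Matrix.inv_def, Ring.inverse_eq_inv']

end MetricCalculus

end PseudoRiemannian

namespace PseudoRiemannian

variable {V : Type*} [NormedAddCommGroup V] [NormedSpace ℝ V]
  {M : Type*} [TopologicalSpace M] [ChartedSpace V M] [IsManifold 𝓘(ℝ, V) ∞ M]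
  (g : Metric V M) {x : M}

/-! ### Gram matrices in arbitrary signature. -/

section Gram

variable {g} {ι : Type*} [Fintype ι] [DecidableEq ι] {s : ι → TangentSpace 𝓘(ℝ, V) x}

/-- The Gram matrix of a family of tangent vectors. -/
noncomputable def Metric.gram (g : Metric V M) (s : ι → TangentSpace 𝓘(ℝ, V) x) : Matrix ι ι ℝ :=
  Matrix.of fun a b ↦ g.inner x (s a) (s b)

/-- A kernel vector `c` of the Gram matrix gives `∑ c_b s_b` orthogonal to the whole family. Without
definiteness, `hn` (non-degeneracy of the span) is what makes this sum zero. -/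
theorem Metric.det_gram_ne_zero (hs : LinearIndependent ℝ s)
    (hn : ∀ v ∈ Submodule.span ℝ (Set.range s), (∀ a, g.inner x v (s a) = 0) → v = 0) :
    (g.gram s).det ≠ 0 := by
  rw [ne_eq, ← Matrix.exists_mulVec_eq_zero_iff]
  rintro ⟨c, hc0, hc⟩
  refine hc0 (funext fun a ↦ ?_)
  have h0 : ∑ b, c b • s b = 0 := by
    refine hn _ (Submodule.sum_mem _ fun b _ ↦ Submodule.smul_mem _ _
      (Submodule.subset_span ⟨b, rfl⟩)) fun a ↦ ?_
    rw [g.symm, map_sum]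
    have := congrFun hc a
    simpa [Matrix.mulVec, dotProduct, Metric.gram, mul_comm] using this
  exact Fintype.linearIndependent_iff.1 hs c h0 a

/-- The difference of the two sides lies in the span and is orthogonal to each `s c`, because `G G⁻¹
= 1`. -/
theorem Metric.eq_sum_gram_inv_smul (hs : LinearIndependent ℝ s)
    (hn : ∀ v ∈ Submodule.span ℝ (Set.range s), (∀ a, g.inner x v (s a) = 0) → v = 0)
    {w : TangentSpace 𝓘(ℝ, V) x} (hw : w ∈ Submodule.span ℝ (Set.range s)) :
    w = ∑ a, (∑ b, (g.gram s)⁻¹ a b * g.inner x w (s b)) • s a := by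
  rw [← sub_eq_zero]
  refine hn _ (Submodule.sub_mem _ hw (Submodule.sum_mem _ fun b _ ↦ Submodule.smul_mem _ _
      (Submodule.subset_span ⟨b, rfl⟩))) fun c ↦ ?_
  have h1 : g.gram s * (g.gram s)⁻¹ = 1 :=
    Matrix.mul_nonsing_inv _ (Ne.isUnit (g.det_gram_ne_zero hs hn))
  have h2 := congrFun (congrArg (fun A ↦ A.mulVec fun b ↦ g.inner x w (s b)) h1) c
  rw [Matrix.one_mulVec, ← Matrix.mulVec_mulVec] at h2
  rw [g.symm, map_sub, map_sum, sub_eq_zero, g.symm, ← h2]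
  simp only [Matrix.mulVec, dotProduct, map_smul, smul_eq_mul]
  refine Finset.sum_congr rfl fun a _ ↦ ?_
  rw [mul_comm]
  rfl

end Gram

/-! ### The splitting `TM = E ⊕ E^⊥`. -/

section Splitting

variable {g} {E : Distribution V M}

theorem Metric.tangentPart_mem (v : TangentSpace 𝓘(ℝ, V) x) : g.tangentPart E x v ∈ E x := by
  unfold Metric.tangentPart
  split_ifs with h
  · exact Submodule.projection_apply_mem h v
  · simp

/-- The default value `0` of `tangentPart` also lies in `E x`, so non-degeneracy is not needed. This
allows its use for `E_i^⊥` directly. -/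
theorem Metric.mem_of_normalPart_eq_zero {v : TangentSpace 𝓘(ℝ, V) x}
    (h : g.normalPart E x v = 0) : v ∈ E x := by
  rw [sub_eq_zero.1 (show v - g.tangentPart E x v = 0 from h)]
  exact g.tangentPart_mem v

variable [FiniteDimensional ℝ V]

theorem Metric.isCompl_perp (hE : g.IsNondegenerate E) (x : M) : IsCompl (E x) (g.perp E x) := by
  have : FiniteDimensional ℝ (TangentSpace 𝓘(ℝ, V) x) := inferInstanceAs (FiniteDimensional ℝ V)
  let B : LinearMap.BilinForm ℝ (TangentSpace 𝓘(ℝ, V) x) :=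
    LinearMap.mk₂ ℝ (fun v w ↦ g.inner x v w) (by simp) (by simp) (by simp) (by simp)
  have hB : B.IsRefl := fun v w h ↦ (g.symm x w v).trans h
  refine (LinearMap.BilinForm.isCompl_orthogonal_iff_disjoint (W := E x) hB).2 ?_
  rw [Submodule.disjoint_def]
  exact fun v hv hv' ↦ hE x v hv fun w hw ↦ (g.symm x v w).trans (hv' w hw)

theorem Metric.normalPart_mem_perp (hE : g.IsNondegenerate E) (v : TangentSpace 𝓘(ℝ, V) x) :
    g.normalPart E x v ∈ g.perp E x := by
  have h := g.isCompl_perp hE x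
  have h1 : g.tangentPart E x = (E x).projection (g.perp E x) h := dif_pos h
  have h2 : (E x).projection (g.perp E x) h (g.normalPart E x v) = 0 := by
    simp only [Metric.normalPart, h1, LinearMap.sub_apply, LinearMap.id_apply, map_sub]
    rw [sub_eq_zero, eq_comm]
    exact Submodule.projection_apply_of_mem_left h (Submodule.projection_apply_mem h v)
  exact (Submodule.projection_apply_eq_zero_iff h).1 h2

theorem Metric.inner_tangentPart_left (hE : g.IsNondegenerate E) (v : TangentSpace 𝓘(ℝ, V) x)
    {w : TangentSpace 𝓘(ℝ, V) x} (hw : w ∈ E x) :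
    g.inner x (g.tangentPart E x v) w = g.inner x v w := by
  have h := g.normalPart_mem_perp hE v w hw
  rw [g.symm] at h
  have h2 : g.inner x (v - g.tangentPart E x v) w = 0 := h
  simp only [map_sub, sub_apply] at h2
  linarith

omit [FiniteDimensional ℝ V] in
theorem Metric.inner_normalPart_left {v w : TangentSpace 𝓘(ℝ, V) x} (hw : w ∈ g.perp E x) :
    g.inner x (g.normalPart E x v) w = g.inner x v w := by
  have h := hw _ (g.tangentPart_mem v)
  have h2 : g.inner x (g.normalPart E x v) w =
    g.inner x (v - g.tangentPart E x v) w := rfl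
  simp [h2, h]

theorem Metric.tangentPart_of_mem (hE : g.IsNondegenerate E) {v : TangentSpace 𝓘(ℝ, V) x}
    (hv : v ∈ E x) : g.tangentPart E x v = v := by
  rw [← sub_eq_zero]
  refine hE x _ (Submodule.sub_mem _ (g.tangentPart_mem v) hv) fun w hw ↦ ?_
  simp [g.inner_tangentPart_left hE v hw]

end Splitting

/-! ### Smoothness of projections and of covariant derivatives. -/

section Smoothness

variable {g} {E : Distribution V M}

/-- A section of a non-degenerate subbundle is smooth if its inner products with the members of a
smooth frame are. -/
theorem Metric.contMDiffAt_of_inner_frame {ι : Type*} [Fintype ι] (hE : g.IsNondegenerate E)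
    {s : ι → Π x : M, TangentSpace 𝓘(ℝ, V) x} {W : Π x : M, TangentSpace 𝓘(ℝ, V) x}
    (hs : ∀ a, CMDiffAt ∞ (T% (s a)) x)
    (hli : ∀ᶠ y in nhds x, LinearIndependent ℝ (fun a ↦ s a y))
    (hspan : ∀ᶠ y in nhds x, Submodule.span ℝ (Set.range fun a ↦ s a y) = E y)
    (hmem : ∀ᶠ y in nhds x, W y ∈ E y)
    (hW : ∀ a, CMDiffAt ∞ (fun y ↦ g.inner y (W y) (s a y)) x) : CMDiffAt ∞ (T% W) x := by
  classical
  have hn (y : M) (hy : Submodule.span ℝ (Set.range fun a ↦ s a y) = E y) :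
      ∀ v ∈ Submodule.span ℝ (Set.range fun a ↦ s a y),
        (∀ a, g.inner y v (s a y) = 0) → v = 0 := by
    intro v hv h
    refine hE y v (hy ▸ hv) fun w hw ↦ ?_
    rw [← hy] at hw
    induction hw using Submodule.span_induction with
    | mem w hw => obtain ⟨a, rfl⟩ := hw; exact h a
    | zero => simp
    | add w w' _ _ h1 h2 => simp [h1, h2]
    | smul c w _ h1 => simp [h1]
  have hgram (a b : ι) : CMDiffAt ∞ (fun y ↦ g.gram (fun a ↦ s a y) a b) x :=
    g.contMDiffAt_inner (hs a) (hs b)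
  have hinv := contMDiffAt_matrix_inv_apply hgram
    (g.det_gram_ne_zero hli.self_of_nhds (hn x hspan.self_of_nhds))
  have hsum : CMDiffAt ∞ (T% fun y ↦ ∑ a,
      (∑ b, (g.gram fun a ↦ s a y)⁻¹ a b * g.inner y (W y) (s b y)) • s a y) x :=
    ContMDiffAt.sum_section fun a _ ↦ ContMDiffAt.smul_section
      (f := fun y ↦ ∑ b, (g.gram fun a ↦ s a y)⁻¹ a b * g.inner y (W y) (s b y))
      (contMDiffAt_finsetSum fun b _ ↦ (hinv a b).mul (hW b)) (hs a)
  refine hsum.congr_of_eventuallyEq ?_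
  filter_upwards [hli, hspan, hmem] with y h1 h2 h3
  exact congrArg (TotalSpace.mk y) (g.eq_sum_gram_inv_smul h1 (hn y h2) (h2 ▸ h3))

theorem Distribution.IsSmooth.exists_frame (hE : E.IsSmooth) (x : M) :
    ∃ (m : ℕ) (s : Fin m → Π x : M, TangentSpace 𝓘(ℝ, V) x),
      (∀ᶠ y in nhds x, ∀ a, CMDiffAt ∞ (T% (s a)) y) ∧
      (∀ᶠ y in nhds x, LinearIndependent ℝ (fun a ↦ s a y)) ∧
      (∀ᶠ y in nhds x, Submodule.span ℝ (Set.range fun a ↦ s a y) = E y) := by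
  obtain ⟨U, hU, hxU, m, s, h1, h2⟩ := hE x
  have := hU.mem_nhds hxU
  refine ⟨m, s, ?_, ?_, ?_⟩ <;> filter_upwards [this] with y hy
  · exact fun a ↦ (h1 a).contMDiffAt (hU.mem_nhds hy)
  · exact (h2 y hy).1
  · exact (h2 y hy).2

variable [FiniteDimensional ℝ V]

theorem Metric.contMDiffAt_tangentPart (hs : E.IsSmooth) (hE : g.IsNondegenerate E)
    {X : Π x : M, TangentSpace 𝓘(ℝ, V) x} (hX : CMDiffAt ∞ (T% X) x) :
    CMDiffAt ∞ (T% fun y ↦ g.tangentPart E y (X y)) x := by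
  obtain ⟨m, s, h1, h2, h3⟩ := hs.exists_frame x
  refine g.contMDiffAt_of_inner_frame hE h1.self_of_nhds h2 h3
    (Filter.Eventually.of_forall fun y ↦ g.tangentPart_mem _) fun a ↦ ?_
  refine (g.contMDiffAt_inner hX (h1.self_of_nhds a)).congr_of_eventuallyEq ?_
  filter_upwards [h3] with y hy
  exact g.inner_tangentPart_left hE _ (hy ▸ Submodule.subset_span ⟨a, rfl⟩)

theorem Metric.contMDiffAt_normalPart (hs : E.IsSmooth) (hE : g.IsNondegenerate E)
    {X : Π x : M, TangentSpace 𝓘(ℝ, V) x} (hX : CMDiffAt ∞ (T% X) x) :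
    CMDiffAt ∞ (T% fun y ↦ g.normalPart E y (X y)) x :=
  hX.sub_section (g.contMDiffAt_tangentPart hs hE hX)

/-- A vector field is smooth if its inner products with smooth vector fields are. -/
theorem Metric.contMDiffAt_of_inner {W : Π x : M, TangentSpace 𝓘(ℝ, V) x}
    (hW : ∀ Z : Π x : M, TangentSpace 𝓘(ℝ, V) x, CMDiffAt ∞ (T% Z) x →
      CMDiffAt ∞ (fun y ↦ g.inner y (W y) (Z y)) x) : CMDiffAt ∞ (T% W) x := by
  let e := trivializationAt V (TangentSpace 𝓘(ℝ, V) : M → Type _) x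
  have hx : x ∈ e.baseSet := mem_baseSet_trivializationAt' x
  have hf := e.isLocalFrameOn_localFrame_baseSet 𝓘(ℝ, V) ∞ (Module.finBasis ℝ V)
  have hsm (a) := hf.contMDiffAt e.open_baseSet hx a
  -- The frame criterion is applied to the full tangent bundle, regarded as a non-degenerate
  -- distribution.
  refine g.contMDiffAt_of_inner_frame (E := fun _ ↦ ⊤) (s := e.localFrame (Module.finBasis ℝ V))
    (fun y v _ h ↦ g.nondegenerate y v fun w ↦ h w trivial) hsm ?_ ?_ (by simp)
    fun a ↦ hW _ (hsm a)
  · filter_upwards [e.open_baseSet.mem_nhds hx] with y hy using hf.linearIndependent hy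
  · filter_upwards [e.open_baseSet.mem_nhds hx] with y hy using top_le_iff.1 (hf.generating hy)

theorem Metric.contMDiffAt_leviCivita {X Y : Π x : M, TangentSpace 𝓘(ℝ, V) x}
    (hX : CMDiffAt ∞ (T% X) x) (hY : CMDiffAt ∞ (T% Y) x) :
    CMDiffAt ∞ (T% fun y ↦ g.leviCivita Y y (X y)) x := by
  refine g.contMDiffAt_of_inner fun Z hZ ↦ ?_
  refine (g.contMDiffAt_koszul hX hY hZ).congr_of_eventuallyEq ?_
  filter_upwards [eventually_mdifferentiableAt hX, eventually_mdifferentiableAt hY,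
    eventually_mdifferentiableAt hZ] with y h1 h2 h3
  exact g.inner_leviCivitaAt h2 h1 h3

end Smoothness

end PseudoRiemannian

namespace PseudoRiemannian

variable {V : Type*} [NormedAddCommGroup V] [NormedSpace ℝ V]
  {M : Type*} [TopologicalSpace M] [ChartedSpace V M]

/-! ### Local sections and the mean curvature of an umbilical distribution. -/

section Sections

variable {E : Distribution V M} {U U' : Set M} {X Y : Π x : M, TangentSpace 𝓘(ℝ, V) x} {x : M}

theorem mvfderiv_congr {f f' : M → ℝ} (h : f =ᶠ[nhds x] f') : d% f x = d% f' x := by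
  ext v
  change (mfderiv 𝓘(ℝ, V) 𝓘(ℝ, ℝ) f x v : ℝ) = mfderiv 𝓘(ℝ, V) 𝓘(ℝ, ℝ) f' x v
  rw [h.mfderiv_eq]
  rfl

theorem mvfderiv_eq_zero_of_eventually {f : M → ℝ} (h : ∀ᶠ y in nhds x, f y = 0) :
    d% f x = 0 := by
  rw [mvfderiv_congr (f' := fun _ ↦ 0) h, mvfderiv_const]

variable [IsManifold 𝓘(ℝ, V) ∞ M]

theorem Distribution.IsSectionOn.contMDiffAt (hX : E.IsSectionOn U X) (hU : IsOpen U)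
    (hx : x ∈ U) : CMDiffAt ∞ (T% X) x :=
  hX.smooth.contMDiffAt (hU.mem_nhds hx)

theorem Distribution.IsSectionOn.mdifferentiableAt (hX : E.IsSectionOn U X) (hU : IsOpen U)
    (hx : x ∈ U) : MDiffAt (T% X) x :=
  (hX.contMDiffAt hU hx).mdifferentiableAt (by simp)

theorem Distribution.IsSectionOn.mono (hX : E.IsSectionOn U X) (h : U' ⊆ U) :
    E.IsSectionOn U' X :=
  ⟨hX.smooth.mono h, fun x hx ↦ hX.mem x (h hx)⟩

theorem Distribution.IsSectionOn.of_le {E' : Distribution V M} (hX : E.IsSectionOn U X)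
    (h : ∀ x, E x ≤ E' x) : E'.IsSectionOn U X :=
  ⟨hX.smooth, fun x hx ↦ h x (hX.mem x hx)⟩

variable (V) in
/-- The domain of the canonical trivialization of the tangent bundle at `x`, on which the canonical
extensions of tangent vectors at `x` are smooth. -/
def trivNhd (x : M) : Set M := (trivializationAt V (TangentSpace 𝓘(ℝ, V) : M → Type _) x).baseSet

theorem isOpen_trivNhd (x : M) : IsOpen (trivNhd V x) := Trivialization.open_baseSet _

theorem mem_trivNhd (x : M) : x ∈ trivNhd V x := mem_baseSet_trivializationAt' x

theorem contMDiffOn_extend_trivNhd (v : TangentSpace 𝓘(ℝ, V) x) :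
    CMDiff[trivNhd V x] ∞ (T% (extend V v)) := by
  set t := trivializationAt V (TangentSpace 𝓘(ℝ, V) : M → Type _) x
  intro y hy
  rw [t.contMDiffWithinAt_section _ hy]
  have : CMDiff[t.baseSet] ∞ (fun _ : M ↦ (t ⟨x, v⟩).2) := contMDiffOn_const
  -- In the trivialization at `x` the extension has constant coordinates.
  have h (z : M) (hz : z ∈ t.baseSet) : (t ⟨z, extend V v z⟩).2 = (t ⟨x, v⟩).2 := by
    unfold extend
    have := congrArg Prod.snd (t.apply_mk_symm hz (t ⟨x, v⟩).2)
    exact this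
  exact (this y hy).congr h (h y hy)

variable (g : Metric V M) [FiniteDimensional ℝ V]

theorem Metric.isSectionOn_sectionThrough (hs : E.IsSmooth) (hE : g.IsNondegenerate E) (v : E x) :
    E.IsSectionOn (trivNhd V x) (g.sectionThrough E v) where
  smooth _ hy := (g.contMDiffAt_tangentPart hs hE ((contMDiffOn_extend_trivNhd
    (v : TangentSpace 𝓘(ℝ, V) x)).contMDiffAt ((isOpen_trivNhd x).mem_nhds hy))).contMDiffWithinAt
  mem _ _ := g.tangentPart_mem _

theorem Metric.sectionThrough_self (hE : g.IsNondegenerate E) (v : E x) :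
    g.sectionThrough E v x = v := by
  simp only [Metric.sectionThrough, extend_apply_self]
  exact g.tangentPart_of_mem hE v.2

-- Vectors may be null, so a pair with non-zero product replaces a unit vector in all later
-- normalizations.
omit [FiniteDimensional ℝ V] in
theorem Metric.exists_inner_ne_zero (hE : g.IsNondegenerate E) (h0 : E x ≠ ⊥) :
    ∃ v w : E x, g.inner x v w ≠ 0 := by
  obtain ⟨v, hv, hv0⟩ := (Submodule.ne_bot_iff _).1 h0
  by_contra! h
  exact hv0 (hE x v hv fun w hw ↦ h ⟨v, hv⟩ ⟨w, hw⟩)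

omit [FiniteDimensional ℝ V] in
theorem Metric.inner_eq_zero_of_isSectionOn_perp (hX : E.IsSectionOn U X)
    (hY : (g.perp E).IsSectionOn U Y) (hx : x ∈ U) : g.inner x (X x) (Y x) = 0 :=
  hY.mem x hx _ (hX.mem x hx)

/-- The metric trace of an umbilical second fundamental form. -/
theorem Metric.meanCurvature_eq (hE : g.IsNondegenerate E) (h0 : E x ≠ ⊥)
    {N : TangentSpace 𝓘(ℝ, V) x}
    (hN : ∀ v w : E x, g.genSecondForm E (g.sectionThrough E v) (g.sectionThrough E w) x =
      g.inner x v w • N) : g.meanCurvature E x = N := by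
  have : FiniteDimensional ℝ (TangentSpace 𝓘(ℝ, V) x) := inferInstanceAs (FiniteDimensional ℝ V)
  have hII (v w : E x) : g.secondForm E (g.sectionThrough E v) (g.sectionThrough E w) x =
      g.inner x w v • N := by
    have h1 := hN v w
    have h2 := hN w v
    unfold Metric.genSecondForm at h1 h2
    rw [Metric.secondForm, map_add, h1, h2, g.symm x w v, ← two_smul ℝ, smul_smul]
    norm_num
  let m := Module.finrank ℝ (E x)
  have hm : (m : ℝ) ≠ 0 := by
    have : Nontrivial (E x) := (Submodule.nontrivial_iff_ne_bot).2 h0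
    exact_mod_cast (Module.finrank_pos (R := ℝ) (M := E x)).ne'
  let e : Module.Basis (Fin m) ℝ (E x) := Module.finBasis ℝ (E x)
  let s : Fin m → TangentSpace 𝓘(ℝ, V) x := fun a ↦ e a
  have hli : LinearIndependent ℝ s :=
    e.linearIndependent.map' (E x).subtype (Submodule.ker_subtype _)
  have hspan : Submodule.span ℝ (Set.range s) = E x := by
    have := congrArg (Submodule.map (E x).subtype) e.span_eq
    rw [Submodule.map_span, ← Set.range_comp, Submodule.map_subtype_top] at this
    exact this
  have hdet : (g.gram s).det ≠ 0 := by
    refine g.det_gram_ne_zero hli fun v hv h ↦ hE x v (hspan ▸ hv) fun w hw ↦ ?_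
    rw [← hspan] at hw
    induction hw using Submodule.span_induction with
    | mem w hw => obtain ⟨a, rfl⟩ := hw; exact h a
    | zero => simp
    | add w w' _ _ h1 h2 => simp [h1, h2]
    | smul c w _ h1 => simp [h1]
  have hinv := Matrix.nonsing_inv_mul _ (Ne.isUnit hdet)
  -- The metric trace of `⟨·,·⟩ N` is `tr(G⁻¹G) N = m N`, which cancels the factor `1 / m`.
  have htr : ∑ a, ∑ b, (g.gram s)⁻¹ a b * g.gram s b a = m := by
    have := congrArg Matrix.trace hinv
    simpa [Matrix.trace, Matrix.mul_apply] using this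
  change (1 / m : ℝ) • ∑ a, ∑ b, (g.gram s)⁻¹ a b •
    g.secondForm E (g.sectionThrough E (e a)) (g.sectionThrough E (e b)) x = N
  have : ∑ a, ∑ b, (g.gram s)⁻¹ a b •
      g.secondForm E (g.sectionThrough E (e a)) (g.sectionThrough E (e b)) x = (m : ℝ) • N := by
    rw [← htr, Finset.sum_smul]
    refine Finset.sum_congr rfl fun a _ ↦ ?_
    rw [Finset.sum_smul]
    refine Finset.sum_congr rfl fun b _ ↦ ?_
    rw [hII, smul_smul]
    rfl
  rw [this, smul_smul, one_div_mul_cancel hm, one_smul]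

end Sections

/-! ### Orthogonal nets and brackets of their sections. -/

section Nets

variable [IsManifold 𝓘(ℝ, V) ∞ M] {g : Metric V M} {k : ℕ} {E : Fin k → Distribution V M}
  {U : Set M} {X Y Z : Π x : M, TangentSpace 𝓘(ℝ, V) x} {x : M} {i j : Fin k}

theorem Metric.IsOrthogonallyIntegrable.le_perp (hE : g.IsOrthogonallyIntegrable E) (hij : i ≠ j)
    (x : M) : E j x ≤ g.perp (E i) x :=
  fun w hw v hv ↦ hE.orthogonal i j hij x v hv w hw

theorem Metric.IsOrthogonallyIntegrable.ext (hE : g.IsOrthogonallyIntegrable E)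
    {v w : TangentSpace 𝓘(ℝ, V) x} (h : ∀ j, ∀ z ∈ E j x, g.inner x v z = g.inner x w z) :
    v = w := by
  rw [← sub_eq_zero]
  refine g.nondegenerate x _ fun z ↦ ?_
  have hz : z ∈ ⨆ j, E j x := by
    rw [(hE.directSum x).submodule_iSup_eq_top]; trivial
  induction hz using Submodule.iSup_induction' with
  | mem j z hz => simp [h j z hz]
  | zero => simp
  | add a b _ _ ha hb => rw [map_add, ha, hb, add_zero]

/-- Reduces identities between normal components to pairings with one `E_j`, `j ≠ i`, at a time. -/
theorem Metric.IsOrthogonallyIntegrable.eq_of_mem_perp (hE : g.IsOrthogonallyIntegrable E)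
    {v w : TangentSpace 𝓘(ℝ, V) x} (hv : v ∈ g.perp (E i) x) (hw : w ∈ g.perp (E i) x)
    (h : ∀ j, i ≠ j → ∀ z ∈ E j x, g.inner x v z = g.inner x w z) : v = w := by
  refine hE.ext fun j z hz ↦ ?_
  by_cases hij : i = j
  · subst hij
    rw [g.symm x v, g.symm x w, hv z hz, hw z hz]
  · exact h j hij z hz

/-- The only use of the product structure: coordinates of the factors other than `i` and `j` are
annihilated by `X` and `Y`, hence by their commutator. -/
theorem Metric.IsOrthogonallyIntegrable.mlieBracket_mem [FiniteDimensional ℝ V]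
    (hE : g.IsOrthogonallyIntegrable E) (hU : IsOpen U)
    (hX : (E i).IsSectionOn U X) (hY : (E j).IsSectionOn U Y) (hx : x ∈ U) :
    mlieBracket 𝓘(ℝ, V) X Y x ∈ E i x ⊔ E j x := by
  have : CompleteSpace V := FiniteDimensional.complete ℝ V
  obtain ⟨m, φ, S, hxφ, hφ, -, -, -, hmem⟩ := hE.decomposable x
  set D : Π y : M, TangentSpace 𝓘(ℝ, V) y →L[ℝ] (Π i, EuclideanSpace ℝ (Fin (m i))) :=
    fun y ↦ mfderiv 𝓘(ℝ, V) 𝓘(ℝ, Π i, EuclideanSpace ℝ (Fin (m i))) φ y with hD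
  replace hmem : ∀ q ∈ φ.source, ∀ (i : Fin k) (v : TangentSpace 𝓘(ℝ, V) q),
    v ∈ E i q ↔ ∀ j, j ≠ i → D q v j = 0 := hmem
  have hD0 (l : Fin k) (hli : l ≠ i) (hlj : l ≠ j) : D x (mlieBracket 𝓘(ℝ, V) X Y x) l = 0 := by
    ext a
    let L : (Π i, EuclideanSpace ℝ (Fin (m i))) →L[ℝ] ℝ :=
      (EuclideanSpace.proj a).comp (ContinuousLinearMap.proj l)
    have hφat (y : M) (hy : y ∈ φ.source) : ContMDiffAt 𝓘(ℝ, V) _ ∞ φ y :=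
      hφ.contMDiffAt (φ.open_source.mem_nhds hy)
    have hf (y : M) (hy : y ∈ φ.source) : CMDiffAt ∞ (fun y ↦ L (φ y)) y :=
      L.contMDiff.contMDiffAt.comp y (hφat y hy)
    have hdf (y : M) (hy : y ∈ φ.source) (v : TangentSpace 𝓘(ℝ, V) y) :
        d% (fun y ↦ L (φ y)) y v = L (D y v) := by
      have h1 := mfderiv_comp y L.mdifferentiableAt
        ((hφat y hy).mdifferentiableAt (by simp))
      rw [L.mfderiv_eq] at h1
      exact congrArg (fun A ↦ A v) h1
    have hzero (W : Π x : M, TangentSpace 𝓘(ℝ, V) x) (n : Fin k) (hn : l ≠ n)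
        (hW : (E n).IsSectionOn U W) :
        ∀ᶠ y in nhds x, d% (fun y ↦ L (φ y)) y (W y) = 0 := by
      filter_upwards [φ.open_source.mem_nhds hxφ, hU.mem_nhds hx] with y hy hyU
      rw [hdf y hy]
      have := (hmem y hy n _).1 (hW.mem y hyU) l hn
      simp [L, this]
    have h := mvfderiv_mlieBracket_apply (hf x hxφ) (hX.contMDiffAt hU hx) (hY.contMDiffAt hU hx)
    rw [hdf x hxφ, mvfderiv_eq_zero_of_eventually (hzero X i hli hX),
      mvfderiv_eq_zero_of_eventually (hzero Y j hlj hY)] at h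
    simpa [L] using h
  have hv : mlieBracket 𝓘(ℝ, V) X Y x ∈ ⨆ j, E j x := by
    rw [(hE.directSum x).submodule_iSup_eq_top]; trivial
  obtain ⟨c, hc, hsum⟩ := (Submodule.mem_iSup_iff_exists_finsupp _ _).1 hv
  rw [Finsupp.sum_fintype _ _ fun _ ↦ rfl] at hsum
  rw [← hsum] at hD0 ⊢
  refine Submodule.sum_mem _ fun l _ ↦ ?_
  by_cases hli : l = i
  · exact Submodule.mem_sup_left (hli ▸ hc l)
  by_cases hlj : l = j
  · exact Submodule.mem_sup_right (hlj ▸ hc l)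
  have hDl : D x (c l) l = 0 := by
    rw [← hD0 l hli hlj, map_sum, Finset.sum_apply, Finset.sum_eq_single l]
    · exact fun n _ hn ↦ (hmem x hxφ n _).1 (hc n) l hn.symm
    · simp
  -- All blocks of `D x (c l)` vanish, so `c l` passes the membership test for `E i` too. It is then
  -- orthogonal to `E l`, in which it lies, and so is zero.
  have hi : c l ∈ E i x := by
    refine (hmem x hxφ i _).2 fun n _ ↦ ?_
    by_cases hnl : n = l
    · exact hnl ▸ hDl
    · exact (hmem x hxφ l _).1 (hc l) n hnl
  rw [hE.nondegenerate l x (c l) (hc l) fun w hw ↦ hE.orthogonal i l (Ne.symm hli) x _ hi w hw]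
  exact Submodule.zero_mem _

end Nets

end PseudoRiemannian

/-! ### The conformal Killing equation on eigenvector fields. -/

namespace PseudoRiemannian

variable {V : Type*} [NormedAddCommGroup V] [NormedSpace ℝ V]
  {M : Type*} [TopologicalSpace M] [ChartedSpace V M] [IsManifold 𝓘(ℝ, V) ∞ M]
  {g : Metric V M} {x : M} {T : Π x : M, TangentSpace 𝓘(ℝ, V) x →L[ℝ] TangentSpace 𝓘(ℝ, V) x}

theorem Metric.IsSymmetricTensor.contMDiffAt_apply (hT : g.IsSymmetricTensor T)
    {X : Π x : M, TangentSpace 𝓘(ℝ, V) x} (hX : CMDiffAt ∞ (T% X) x) :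
    CMDiffAt ∞ (T% fun y ↦ T y (X y)) x :=
  ContMDiffAt.clm_bundle_apply (F₁ := V) (F₂ := V)
    (E₁ := (TangentSpace 𝓘(ℝ, V) : M → Type _)) (E₂ := (TangentSpace 𝓘(ℝ, V) : M → Type _))
    (hT.smooth x) hX

variable [FiniteDimensional ℝ V]

/-- In this product-rule form, `T` acts on `Y` and `Z` themselves, so on eigenvector fields it
becomes a scalar factor. -/
theorem Metric.IsSymmetricTensor.covDerivTensor_eq (hT : g.IsSymmetricTensor T)
    {X Y Z : Π x : M, TangentSpace 𝓘(ℝ, V) x} (hX : CMDiffAt ∞ (T% X) x)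
    (hY : CMDiffAt ∞ (T% Y) x) (hZ : CMDiffAt ∞ (T% Z) x) :
    g.covDerivTensor T X Y Z x = d% (fun y ↦ g.inner y (T y (Y y)) (Z y)) x (X x)
      - g.inner x (T x (Y x)) (g.leviCivita Z x (X x))
      - g.inner x (g.leviCivita Y x (X x)) (T x (Z x)) := by
  have h := g.leviCivita_metric (hX.mdifferentiableAt (by simp))
    ((hT.contMDiffAt_apply hY).mdifferentiableAt (by simp)) (hZ.mdifferentiableAt (by simp))
  rw [h, ← hT.symm, Metric.covDerivTensor]
  simp only [map_sub, sub_apply]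
  ring

/-- `t` is a conformal factor of `T`. -/
def Metric.IsConformalFactor (g : Metric V M)
    (T : Π x : M, TangentSpace 𝓘(ℝ, V) x →L[ℝ] TangentSpace 𝓘(ℝ, V) x)
    (t : Π x : M, TangentSpace 𝓘(ℝ, V) x) : Prop :=
  ∀ (U : Set M) (X Y Z : Π x : M, TangentSpace 𝓘(ℝ, V) x), IsOpen U →
    CMDiff[U] ∞ (T% X) → CMDiff[U] ∞ (T% Y) → CMDiff[U] ∞ (T% Z) → ∀ x ∈ U,
      g.covDerivTensor T X Y Z x + g.covDerivTensor T Y Z X x + g.covDerivTensor T Z X Y x =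
        g.inner x (t x) (X x) * g.inner x (Y x) (Z x)
          + g.inner x (t x) (Y x) * g.inner x (Z x) (X x)
          + g.inner x (t x) (Z x) * g.inner x (X x) (Y x)

namespace Metric.IsConformalKillingNet

variable {k : ℕ} {lam : Fin k → M → ℝ} {E : Fin k → Distribution V M}
  {U : Set M} {X Y Z : Π x : M, TangentSpace 𝓘(ℝ, V) x} {i j : Fin k}
  {t : Π x : M, TangentSpace 𝓘(ℝ, V) x}

theorem isSectionOn_sectionThrough (hE : g.IsConformalKillingNet T lam E) (v : E i x) :
    (E i).IsSectionOn (trivNhd V x) (g.sectionThrough (E i) v) :=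
  g.isSectionOn_sectionThrough (hE.orthogonallyIntegrable.smooth i)
    (hE.orthogonallyIntegrable.nondegenerate i) v

theorem sectionThrough_self (hE : g.IsConformalKillingNet T lam E) (v : E i x) :
    g.sectionThrough (E i) v x = v :=
  g.sectionThrough_self (hE.orthogonallyIntegrable.nondegenerate i) v

theorem exists_inner_ne_zero (hE : g.IsConformalKillingNet T lam E) (i : Fin k) (x : M) :
    ∃ v w : E i x, g.inner x v w ≠ 0 :=
  g.exists_inner_ne_zero (hE.orthogonallyIntegrable.nondegenerate i) (hE.ne_bot i x)

/-- The eigenfunctions are smooth. -/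
theorem contMDiffAt_eigenfunction (hE : g.IsConformalKillingNet T lam E) (i : Fin k) (x : M) :
    CMDiffAt ∞ (lam i) x := by
  obtain ⟨v, w, hvw⟩ := hE.exists_inner_ne_zero i x
  have hX := hE.isSectionOn_sectionThrough v
  have hY := hE.isSectionOn_sectionThrough w
  have hXs := hX.contMDiffAt (isOpen_trivNhd x) (mem_trivNhd x)
  have hYs := hY.contMDiffAt (isOpen_trivNhd x) (mem_trivNhd x)
  have hXY := g.contMDiffAt_inner hXs hYs
  have hTXY := g.contMDiffAt_inner
    (hE.conformalKilling.symmetricTensor.contMDiffAt_apply hXs) hYs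
  have h0 : g.inner x (g.sectionThrough (E i) v x) (g.sectionThrough (E i) w x) ≠ 0 := by
    rwa [hE.sectionThrough_self, hE.sectionThrough_self]
  -- Near `x`, `λ_i = ⟨TX, Y⟩ / ⟨X, Y⟩`.
  refine (hTXY.div₀ hXY h0).congr_of_eventuallyEq ?_
  filter_upwards [(isOpen_trivNhd (V := V) x).mem_nhds (mem_trivNhd x),
    hXY.continuousAt.eventually_ne h0] with y hy hy0
  rw [Pi.div_apply, (hE.mem_iff i y _).1 (hX.mem y hy), map_smul, smul_apply, smul_eq_mul,
    mul_div_cancel_right₀ _ hy0]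

theorem mdifferentiableAt_eigenfunction (hE : g.IsConformalKillingNet T lam E) (i : Fin k)
    (x : M) : MDiffAt (lam i) x :=
  (hE.contMDiffAt_eigenfunction i x).mdifferentiableAt (by simp)

/-- Metric compatibility for sections of two orthogonal eigendistributions. -/
theorem inner_leviCivita_swap (hE : g.IsConformalKillingNet T lam E) (hij : i ≠ j)
    (hU : IsOpen U) (hX : CMDiff[U] ∞ (T% X)) (hY : (E i).IsSectionOn U Y)
    (hZ : (E j).IsSectionOn U Z) (hx : x ∈ U) :
    g.inner x (Y x) (g.leviCivita Z x (X x)) = -g.inner x (g.leviCivita Y x (X x)) (Z x) := by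
  have h := g.leviCivita_metric ((hX.contMDiffAt (hU.mem_nhds hx)).mdifferentiableAt (by simp))
    (hY.mdifferentiableAt hU hx) (hZ.mdifferentiableAt hU hx)
  rw [mvfderiv_eq_zero_of_eventually] at h
  · simp only [zero_apply] at h
    linarith
  · filter_upwards [hU.mem_nhds hx] with y hy
    exact hE.orthogonallyIntegrable.orthogonal i j hij y _ (hY.mem y hy) _ (hZ.mem y hy)

/-- `⟨TY, Z⟩` vanishes near `x`; metric compatibility combines the two remaining connection terms.
-/
theorem covDerivTensor_of_ne (hE : g.IsConformalKillingNet T lam E) (hij : i ≠ j)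
    (hU : IsOpen U) (hX : CMDiff[U] ∞ (T% X)) (hY : (E i).IsSectionOn U Y)
    (hZ : (E j).IsSectionOn U Z) (hx : x ∈ U) :
    g.covDerivTensor T X Y Z x =
      (lam i x - lam j x) * g.inner x (g.leviCivita Y x (X x)) (Z x) := by
  rw [hE.conformalKilling.symmetricTensor.covDerivTensor_eq (hX.contMDiffAt (hU.mem_nhds hx))
    (hY.contMDiffAt hU hx) (hZ.contMDiffAt hU hx), (hE.mem_iff i x _).1 (hY.mem x hx),
    (hE.mem_iff j x _).1 (hZ.mem x hx), mvfderiv_eq_zero_of_eventually]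
  · simp only [zero_apply, map_smul, smul_apply, smul_eq_mul,
      hE.inner_leviCivita_swap hij hU hX hY hZ hx]
    ring
  · filter_upwards [hU.mem_nhds hx] with y hy
    rw [(hE.mem_iff i y _).1 (hY.mem y hy), map_smul, smul_apply,
      hE.orthogonallyIntegrable.orthogonal i j hij y _ (hY.mem y hy) _ (hZ.mem y hy), smul_zero]

/-- On `E_i`, `T` is `λ_i g` and `g` is parallel, so only the derivative of `λ_i` survives. -/
theorem covDerivTensor_of_eq (hE : g.IsConformalKillingNet T lam E)
    (hU : IsOpen U) (hX : CMDiff[U] ∞ (T% X)) (hY : (E i).IsSectionOn U Y)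
    (hZ : (E i).IsSectionOn U Z) (hx : x ∈ U) :
    g.covDerivTensor T X Y Z x = d% (lam i) x (X x) * g.inner x (Y x) (Z x) := by
  have hXs := hX.contMDiffAt (hU.mem_nhds hx)
  have hYZ := g.contMDiffAt_inner (hY.contMDiffAt hU hx) (hZ.contMDiffAt hU hx)
  have h1 : (fun y ↦ g.inner y (T y (Y y)) (Z y)) =ᶠ[nhds x]
      fun y ↦ lam i y * g.inner y (Y y) (Z y) := by
    filter_upwards [hU.mem_nhds hx] with y hy
    rw [(hE.mem_iff i y _).1 (hY.mem y hy), map_smul, smul_apply, smul_eq_mul]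
  rw [hE.conformalKilling.symmetricTensor.covDerivTensor_eq hXs
    (hY.contMDiffAt hU hx) (hZ.contMDiffAt hU hx), (hE.mem_iff i x _).1 (hY.mem x hx),
    (hE.mem_iff i x _).1 (hZ.mem x hx), mvfderiv_congr h1,
    mvfderiv_fun_mul (hE.mdifferentiableAt_eigenfunction i x)
      (hYZ.mdifferentiableAt (by simp))]
  have h := g.leviCivita_metric (hXs.mdifferentiableAt (by simp))
    (hY.mdifferentiableAt hU hx) (hZ.mdifferentiableAt hU hx)
  simp only [add_apply, smul_apply, map_smul, smul_eq_mul, h]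
  ring

/-- The eigendistributions are integrable. -/
theorem inner_leviCivita_comm (hE : g.IsConformalKillingNet T lam E) (hij : i ≠ j)
    (hU : IsOpen U) (hX : (E i).IsSectionOn U X) (hY : (E i).IsSectionOn U Y) (hx : x ∈ U)
    {z : TangentSpace 𝓘(ℝ, V) x} (hz : z ∈ E j x) :
    g.inner x (g.leviCivita Y x (X x)) z = g.inner x (g.leviCivita X x (Y x)) z := by
  have h := g.leviCivita_torsion (hX.mdifferentiableAt hU hx) (hY.mdifferentiableAt hU hx)
  have h1 := hE.orthogonallyIntegrable.mlieBracket_mem hU hX hY hx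
  rw [sup_idem, ← h] at h1
  have h2 := hE.orthogonallyIntegrable.orthogonal i j hij x _ h1 z hz
  simp only [map_sub, sub_apply] at h2
  linarith

/-- Orthogonality removes two terms in `t`; integrability of `E_i` equates two terms in `∇T`, whence
the factor 2. The right side sees `X`, `Y` only through `⟨X, Y⟩`, which is the source of umbilicity.
-/
theorem inner_leviCivita_eq (hE : g.IsConformalKillingNet T lam E)
    (ht : g.IsConformalFactor T t) (hij : i ≠ j)
    (hU : IsOpen U) (hX : (E i).IsSectionOn U X) (hY : (E i).IsSectionOn U Y)
    (hZ : (E j).IsSectionOn U Z) (hx : x ∈ U) :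
    2 * (lam i x - lam j x) * g.inner x (g.leviCivita Y x (X x)) (Z x) =
      (g.inner x (t x) (Z x) - d% (lam i) x (Z x)) * g.inner x (X x) (Y x) := by
  have h := ht U X Y Z hU hX.smooth hY.smooth hZ.smooth x hx
  rw [hE.covDerivTensor_of_ne hij hU hX.smooth hY hZ hx,
    hE.covDerivTensor_of_ne hij.symm hU hY.smooth hZ hX hx,
    hE.covDerivTensor_of_eq hU hZ.smooth hX hY hx,
    hE.orthogonallyIntegrable.orthogonal i j hij x _ (hY.mem x hx) _ (hZ.mem x hx),
    hE.orthogonallyIntegrable.orthogonal j i hij.symm x _ (hZ.mem x hx) _ (hX.mem x hx),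
    g.symm x (g.leviCivita Z x (Y x)),
    hE.inner_leviCivita_swap hij hU hY.smooth hX hZ hx,
    ← hE.inner_leviCivita_comm hij hU hX hY hx (hZ.mem x hx)] at h
  linear_combination h

/-- Along its own eigendistribution an eigenfunction varies as prescribed by the conformal
factor. -/
theorem mvfderiv_eigenfunction_self (hE : g.IsConformalKillingNet T lam E)
    (ht : g.IsConformalFactor T t) {v : TangentSpace 𝓘(ℝ, V) x} (hv : v ∈ E i x) :
    d% (lam i) x v = g.inner x (t x) v := by
  have key (u v w : E i x) :
      (d% (lam i) x u - g.inner x (t x) u) * g.inner x v w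
        + (d% (lam i) x v - g.inner x (t x) v) * g.inner x w u
        + (d% (lam i) x w - g.inner x (t x) w) * g.inner x u v = 0 := by
    have hu := hE.isSectionOn_sectionThrough u
    have hv := hE.isSectionOn_sectionThrough v
    have hw := hE.isSectionOn_sectionThrough w
    have h := ht _ _ _ _ (isOpen_trivNhd x) hu.smooth hv.smooth hw.smooth x (mem_trivNhd x)
    rw [hE.covDerivTensor_of_eq (isOpen_trivNhd x) hu.smooth hv hw (mem_trivNhd x),
      hE.covDerivTensor_of_eq (isOpen_trivNhd x) hv.smooth hw hu (mem_trivNhd x),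
      hE.covDerivTensor_of_eq (isOpen_trivNhd x) hw.smooth hu hv (mem_trivNhd x)] at h
    simp only [hE.sectionThrough_self] at h
    linear_combination h
  -- Put `ω = dλ_i - ⟨t, ·⟩` and suppose `ω(v) ≠ 0`. The triple `(v, v, v)` forces `v` to be null,
  -- then `(v, v, w)` forces `⟨v, w⟩ = 0` for all `w` in `E_i`, so `v = 0`.
  by_contra hne
  rw [← sub_eq_zero] at hne
  have h1 := key ⟨v, hv⟩ ⟨v, hv⟩ ⟨v, hv⟩
  have hvv : g.inner x v v = 0 := by
    refine (mul_eq_zero.1 ?_).resolve_left hne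
    linear_combination h1 / 3
  have hv0 : v = 0 := by
    refine hE.orthogonallyIntegrable.nondegenerate i x v hv fun w hw ↦ ?_
    have h2 := key ⟨v, hv⟩ ⟨v, hv⟩ ⟨w, hw⟩
    simp only [hvv, g.symm x w v] at h2
    refine (mul_eq_zero.1 ?_).resolve_left hne
    linear_combination h2 / 2
  simp [hv0] at hne

/-- If `E_i^⊥` is geodesic, all eigenfunctions vary along `E_i` as prescribed by the conformal
factor. -/
theorem mvfderiv_eigenfunction_of_isGeodesic_perp (hE : g.IsConformalKillingNet T lam E)
    (ht : g.IsConformalFactor T t) (hi : g.IsGeodesic (g.perp (E i))) (j : Fin k)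
    {v : TangentSpace 𝓘(ℝ, V) x} (hv : v ∈ E i x) :
    d% (lam j) x v = g.inner x (t x) v := by
  by_cases hij : i = j
  · subst hij
    exact hE.mvfderiv_eigenfunction_self ht hv
  obtain ⟨a, b, hab⟩ := hE.exists_inner_ne_zero j x
  have hX := hE.isSectionOn_sectionThrough (⟨v, hv⟩ : E i x)
  have hA := hE.isSectionOn_sectionThrough a
  have hB := hE.isSectionOn_sectionThrough b
  -- The roles of `i` and `j` are exchanged: `∇_A B` stays in `E_i^⊥`, so the left side is zero
  -- while `⟨A, B⟩ ≠ 0`.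
  have h := hE.inner_leviCivita_eq ht (Ne.symm hij) (isOpen_trivNhd x) hA hB hX (mem_trivNhd x)
  have hle := hE.orthogonallyIntegrable.le_perp hij
  have h1 := mem_of_normalPart_eq_zero (hi _ _ _ (isOpen_trivNhd x) (hA.of_le hle) (hB.of_le hle) x
    (mem_trivNhd x)) _ (hX.mem x (mem_trivNhd x))
  rw [g.symm, h1, mul_zero] at h
  simp only [hE.sectionThrough_self] at h
  linarith [(mul_eq_zero.1 h.symm).resolve_right hab]

end Metric.IsConformalKillingNet

end PseudoRiemannian

/-! ### Umbilicity, the mean curvature normal and sphericity. -/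

namespace PseudoRiemannian

variable {V : Type*} [NormedAddCommGroup V] [NormedSpace ℝ V] [FiniteDimensional ℝ V]
  {M : Type*} [TopologicalSpace M] [ChartedSpace V M] [IsManifold 𝓘(ℝ, V) ∞ M]
  {g : Metric V M} {x : M} {T : Π x : M, TangentSpace 𝓘(ℝ, V) x →L[ℝ] TangentSpace 𝓘(ℝ, V) x}

namespace Metric.IsConformalKillingNet

variable {k : ℕ} {lam : Fin k → M → ℝ} {E : Fin k → Distribution V M}
  {U : Set M} {X Y Z : Π x : M, TangentSpace 𝓘(ℝ, V) x} {i j : Fin k}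
  {t : Π x : M, TangentSpace 𝓘(ℝ, V) x}

/-- Umbilicity in cross-multiplied form: `s(X, Y)` is proportional to `⟨X, Y⟩` with a factor
independent of the sections. -/
theorem smul_genSecondForm (hE : g.IsConformalKillingNet T lam E) (ht : g.IsConformalFactor T t)
    {A B : Π x : M, TangentSpace 𝓘(ℝ, V) x} (hU : IsOpen U) (hX : (E i).IsSectionOn U X)
    (hY : (E i).IsSectionOn U Y) (hA : (E i).IsSectionOn U A) (hB : (E i).IsSectionOn U B)
    (hx : x ∈ U) :
    g.inner x (A x) (B x) • g.genSecondForm (E i) X Y x =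
      g.inner x (X x) (Y x) • g.genSecondForm (E i) A B x := by
  have hn := hE.orthogonallyIntegrable.nondegenerate i
  refine hE.orthogonallyIntegrable.eq_of_mem_perp
    (Submodule.smul_mem _ _ (g.normalPart_mem_perp hn _))
    (Submodule.smul_mem _ _ (g.normalPart_mem_perp hn _)) fun j hij z hz ↦ ?_
  have hzp := hE.orthogonallyIntegrable.le_perp hij x hz
  have hZ := (hE.isSectionOn_sectionThrough (⟨z, hz⟩ : E j x)).mono (U' := U ∩ trivNhd V x)
    Set.inter_subset_right
  have hW : IsOpen (U ∩ trivNhd V x) := hU.inter (isOpen_trivNhd x)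
  have hxW : x ∈ U ∩ trivNhd V x := ⟨hx, mem_trivNhd x⟩
  have h1 := hE.inner_leviCivita_eq ht hij hW (hX.mono Set.inter_subset_left)
    (hY.mono Set.inter_subset_left) hZ hxW
  have h2 := hE.inner_leviCivita_eq ht hij hW (hA.mono Set.inter_subset_left)
    (hB.mono Set.inter_subset_left) hZ hxW
  simp only [hE.sectionThrough_self] at h1 h2
  simp only [map_smul, smul_apply, smul_eq_mul, Metric.genSecondForm,
    g.inner_normalPart_left hzp]
  have h0 : 2 * (lam i x - lam j x) ≠ 0 :=
    mul_ne_zero two_ne_zero (sub_ne_zero.2 (hE.distinct i j hij x))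
  refine mul_left_cancel₀ h0 ?_
  linear_combination g.inner x (A x) (B x) * h1 - g.inner x (X x) (Y x) * h2

/-- Eigendistributions of an orthogonally integrable conformal Killing tensor are umbilical. -/
theorem isUmbilical (hE : g.IsConformalKillingNet T lam E) (i : Fin k) :
    g.IsUmbilical (E i) := by
  obtain ⟨t, -, ht⟩ := hE.conformalKilling.exists_conformalFactor
  intro U X Y hU hX hY x hx
  obtain ⟨a, b, hab⟩ := hE.exists_inner_ne_zero i x
  have hA := hE.isSectionOn_sectionThrough a
  have hB := hE.isSectionOn_sectionThrough b
  set N := (g.inner x (a : TangentSpace 𝓘(ℝ, V) x) b)⁻¹ •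
    g.genSecondForm (E i) (g.sectionThrough (E i) a) (g.sectionThrough (E i) b) x with hN
  have key {U : Set M} {X Y : Π x : M, TangentSpace 𝓘(ℝ, V) x} (hU : IsOpen U)
      (hX : (E i).IsSectionOn U X) (hY : (E i).IsSectionOn U Y) (hx : x ∈ U) :
      g.genSecondForm (E i) X Y x = g.inner x (X x) (Y x) • N := by
    have h := hE.smul_genSecondForm ht (hU.inter (isOpen_trivNhd x))
      (hX.mono Set.inter_subset_left) (hY.mono Set.inter_subset_left)
      (hA.mono Set.inter_subset_right) (hB.mono Set.inter_subset_right) ⟨hx, mem_trivNhd x⟩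
    rw [hE.sectionThrough_self, hE.sectionThrough_self] at h
    rw [hN, smul_comm, ← h, inv_smul_smul₀ hab]
  -- Tracing `s = ⟨·,·⟩ N` identifies the proportionality vector `N` with the mean curvature normal.
  rw [g.meanCurvature_eq (hE.orthogonallyIntegrable.nondegenerate i) (hE.ne_bot i x) (N := N)
    fun v w ↦ ?_]
  · exact key hU hX hY hx
  · rw [key (isOpen_trivNhd x) (hE.isSectionOn_sectionThrough v) (hE.isSectionOn_sectionThrough w)
      (mem_trivNhd x), hE.sectionThrough_self, hE.sectionThrough_self]

/-- With `X`, `Y` fixed this holds near a point, so `H` inherits smoothness and normality from `s(X,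
Y)`. -/
theorem meanCurvature_eq_inv_smul (hE : g.IsConformalKillingNet T lam E)
    (hU : IsOpen U) (hX : (E i).IsSectionOn U X) (hY : (E i).IsSectionOn U Y) (hx : x ∈ U)
    (h0 : g.inner x (X x) (Y x) ≠ 0) :
    g.meanCurvature (E i) x = (g.inner x (X x) (Y x))⁻¹ • g.genSecondForm (E i) X Y x := by
  rw [hE.isUmbilical i U X Y hU hX hY x hx, inv_smul_smul₀ h0]

theorem meanCurvature_mem_perp (hE : g.IsConformalKillingNet T lam E) (i : Fin k) (x : M) :
    g.meanCurvature (E i) x ∈ g.perp (E i) x := by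
  obtain ⟨a, b, hab⟩ := hE.exists_inner_ne_zero i x
  rw [hE.meanCurvature_eq_inv_smul (isOpen_trivNhd x) (hE.isSectionOn_sectionThrough a)
    (hE.isSectionOn_sectionThrough b) (mem_trivNhd x)
    (by rwa [hE.sectionThrough_self, hE.sectionThrough_self])]
  exact Submodule.smul_mem _ _
    (g.normalPart_mem_perp (hE.orthogonallyIntegrable.nondegenerate i) _)

theorem contMDiff_meanCurvature (hE : g.IsConformalKillingNet T lam E) (i : Fin k) :
    CMDiff ∞ (T% (g.meanCurvature (E i))) := by
  intro x
  obtain ⟨a, b, hab⟩ := hE.exists_inner_ne_zero i x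
  have hA := hE.isSectionOn_sectionThrough a
  have hB := hE.isSectionOn_sectionThrough b
  have hAs := hA.contMDiffAt (isOpen_trivNhd x) (mem_trivNhd x)
  have hBs := hB.contMDiffAt (isOpen_trivNhd x) (mem_trivNhd x)
  have hAB := g.contMDiffAt_inner hAs hBs
  have h0 : g.inner x (g.sectionThrough (E i) a x) (g.sectionThrough (E i) b x) ≠ 0 := by
    rwa [hE.sectionThrough_self, hE.sectionThrough_self]
  have hII : CMDiffAt ∞ (T% fun y ↦
      g.genSecondForm (E i) (g.sectionThrough (E i) a) (g.sectionThrough (E i) b) y) x :=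
    g.contMDiffAt_normalPart (hE.orthogonallyIntegrable.smooth i)
      (hE.orthogonallyIntegrable.nondegenerate i) (g.contMDiffAt_leviCivita hAs hBs)
  refine ((hAB.inv₀ h0).smul_section hII).congr_of_eventuallyEq ?_
  filter_upwards [(isOpen_trivNhd (V := V) x).mem_nhds (mem_trivNhd x),
    hAB.continuousAt.eventually_ne h0] with y hy hy0
  exact congrArg (TotalSpace.mk y)
    (hE.meanCurvature_eq_inv_smul (isOpen_trivNhd x) hA hB hy hy0)

/-- The component of the mean curvature normal of `E_i` in `E_j` is that of half the gradient of
`-log |λ_i - λ_j|`. -/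
theorem inner_meanCurvature (hE : g.IsConformalKillingNet T lam E)
    (ht : g.IsConformalFactor T t) (hij : i ≠ j) {z : TangentSpace 𝓘(ℝ, V) x} (hz : z ∈ E j x) :
    2 * ((lam i x - lam j x) * g.inner x (g.meanCurvature (E i) x) z) =
      -d% (fun y ↦ lam i y - lam j y) x z := by
  obtain ⟨a, b, hab⟩ := hE.exists_inner_ne_zero i x
  have hA := hE.isSectionOn_sectionThrough a
  have hB := hE.isSectionOn_sectionThrough b
  have hZ := hE.isSectionOn_sectionThrough (⟨z, hz⟩ : E j x)
  have h1 := hE.inner_leviCivita_eq ht hij (isOpen_trivNhd x) hA hB hZ (mem_trivNhd x)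
  have h2 := congrArg (fun w ↦ g.inner x w z)
    (hE.isUmbilical i _ _ _ (isOpen_trivNhd x) hA hB x (mem_trivNhd x))
  simp only [Metric.genSecondForm, map_smul, smul_apply, smul_eq_mul,
    g.inner_normalPart_left (hE.orthogonallyIntegrable.le_perp hij x hz)] at h2
  simp only [hE.sectionThrough_self] at h1 h2
  -- Since `z` lies in `E_j`, the conformal factor is eliminated by `⟨t, z⟩ = dλ_j(z)`.
  rw [h2, ← hE.mvfderiv_eigenfunction_self ht hz] at h1
  have h3 := mvfderiv_fun_sub (hE.mdifferentiableAt_eigenfunction i x)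
    (hE.mdifferentiableAt_eigenfunction j x)
  rw [h3]
  refine mul_right_cancel₀ hab ?_
  simp only [sub_apply]
  linear_combination h1

theorem mvfderiv_eigenfunction_sub (hE : g.IsConformalKillingNet T lam E)
    (ht : g.IsConformalFactor T t) (hi : g.IsGeodesic (g.perp (E i))) (j : Fin k)
    {v : TangentSpace 𝓘(ℝ, V) x} (hv : v ∈ E i x) :
    d% (fun y ↦ lam i y - lam j y) x v = 0 := by
  rw [mvfderiv_fun_sub (hE.mdifferentiableAt_eigenfunction i x)
    (hE.mdifferentiableAt_eigenfunction j x), sub_apply,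
    hE.mvfderiv_eigenfunction_of_isGeodesic_perp ht hi i hv,
    hE.mvfderiv_eigenfunction_of_isGeodesic_perp ht hi j hv, sub_self]

/-- With `Xμ = 0` and `Zμ = -2μ⟨H, Z⟩`, the commutator gives `[X, Z]μ = X(Zμ) = -2μ X⟨H, Z⟩`. -/
theorem mvfderiv_inner_meanCurvature (hE : g.IsConformalKillingNet T lam E)
    (ht : g.IsConformalFactor T t) (hi : g.IsGeodesic (g.perp (E i))) (hij : i ≠ j)
    (hU : IsOpen U) (hX : (E i).IsSectionOn U X) (hZ : (E j).IsSectionOn U Z) (hx : x ∈ U) :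
    d% (fun y ↦ g.inner y (g.meanCurvature (E i) y) (Z y)) x (X x) =
      g.inner x (g.meanCurvature (E i) x) (mlieBracket 𝓘(ℝ, V) X Z x) := by
  have : CompleteSpace V := FiniteDimensional.complete ℝ V
  set μ : M → ℝ := fun y ↦ lam i y - lam j y with hμ
  have hμs : CMDiffAt ∞ μ x :=
    (hE.contMDiffAt_eigenfunction i x).sub (hE.contMDiffAt_eigenfunction j x)
  have hXs := hX.contMDiffAt hU hx
  have hZs := hZ.contMDiffAt hU hx
  have hHZ := g.contMDiffAt_inner (hE.contMDiff_meanCurvature i x) hZs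
  have hXμ : ∀ᶠ y in nhds x, d% μ y (X y) = 0 := by
    filter_upwards [hU.mem_nhds hx] with y hy
    exact hE.mvfderiv_eigenfunction_sub ht hi j (hX.mem y hy)
  have hev : (fun y ↦ d% μ y (Z y)) =ᶠ[nhds x]
      fun y ↦ -2 * (μ y * g.inner y (g.meanCurvature (E i) y) (Z y)) := by
    filter_upwards [hU.mem_nhds hx] with y hy
    linarith [hE.inner_meanCurvature ht hij (hZ.mem y hy)]
  have hμx : μ x ≠ 0 := sub_ne_zero.2 (hE.distinct i j hij x)
  have hμHZ := mvfderiv_fun_mul (hμs.mdifferentiableAt (by simp))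
    (hHZ.mdifferentiableAt (by simp))
  have hμHZ' := mvfderiv_fun_mul (g := fun y ↦ μ y * g.inner y (g.meanCurvature (E i) y) (Z y))
    (mdifferentiableAt_const (c := (-2 : ℝ)) (x := x))
    ((hμs.mul hHZ).mdifferentiableAt (by simp))
  have h1 := mvfderiv_mlieBracket_apply hμs hXs hZs
  rw [mvfderiv_eq_zero_of_eventually hXμ, mvfderiv_congr hev, hμHZ', hμHZ] at h1
  simp only [add_apply, smul_apply, smul_eq_mul, mvfderiv_const, zero_apply,
    hXμ.self_of_nhds] at h1
  -- The `E_i`-part `a` of the bracket is killed both by `dμ` and by `⟨H, ·⟩`; on the `E_j`-part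
  -- `b`, `dμ(b) = -2μ⟨H, b⟩`.
  obtain ⟨a, ha, b, hb, hab⟩ := Submodule.mem_sup.1
    (hE.orthogonallyIntegrable.mlieBracket_mem hU hX hZ hx)
  have h2 := hE.inner_meanCurvature ht hij hb
  have h3 := hE.mvfderiv_eigenfunction_sub ht hi j ha
  have h4 : g.inner x (g.meanCurvature (E i) x) a = 0 := by
    rw [g.symm]; exact hE.meanCurvature_mem_perp i x a ha
  rw [← hab, map_add, h3] at h1
  rw [← hab, map_add, h4]
  refine mul_left_cancel₀ hμx ?_
  change 2 * (μ x * _) = -d% μ x b at h2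
  linarith

/-- Zero torsion turns `⟨H, [X, Z]⟩ - ⟨H, ∇_X Z⟩` into `-⟨H, ∇_Z X⟩`. Differentiating `⟨X, H⟩ = 0`
along `Z` makes this `⟨X, ∇_Z H⟩`, zero as `E_i^⊥` is geodesic. -/
theorem inner_leviCivita_meanCurvature (hE : g.IsConformalKillingNet T lam E)
    (ht : g.IsConformalFactor T t) (hi : g.IsGeodesic (g.perp (E i))) (hij : i ≠ j)
    (hU : IsOpen U) (hX : (E i).IsSectionOn U X) (hZ : (E j).IsSectionOn U Z) (hx : x ∈ U) :
    g.inner x (g.leviCivita (g.meanCurvature (E i)) x (X x)) (Z x) = 0 := by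
  set H := g.meanCurvature (E i)
  have hH : (g.perp (E i)).IsSectionOn U H :=
    ⟨(hE.contMDiff_meanCurvature i).contMDiffOn, fun y _ ↦ hE.meanCurvature_mem_perp i y⟩
  have hXd := hX.mdifferentiableAt hU hx
  have hZd := hZ.mdifferentiableAt hU hx
  have hHd := hH.mdifferentiableAt hU hx
  have h1 := g.leviCivita_metric hXd hHd hZd
  rw [hE.mvfderiv_inner_meanCurvature ht hi hij hU hX hZ hx, ← g.leviCivita_torsion hXd hZd,
    map_sub] at h1
  have h2 := g.leviCivita_metric hZd hXd hHd
  rw [mvfderiv_eq_zero_of_eventually] at h2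
  · have h3 := mem_of_normalPart_eq_zero (hi U Z H hU
      (hZ.of_le (hE.orthogonallyIntegrable.le_perp hij)) hH x hx) _ (hX.mem x hx)
    rw [h3, g.symm] at h2
    simp only [zero_apply] at h2
    linarith
  · filter_upwards [hU.mem_nhds hx] with y hy
    exact g.inner_eq_zero_of_isSectionOn_perp hX hH hy

/-- An eigendistribution of an orthogonally integrable conformal Killing tensor whose orthogonal
complement is geodesic is spherical. -/
theorem isSpherical (hE : g.IsConformalKillingNet T lam E) (hi : g.IsGeodesic (g.perp (E i))) :
    g.IsSpherical (E i) where
  umbilical := hE.isUmbilical i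
  smooth_meanCurvature := hE.contMDiff_meanCurvature i
  parallel U X hU hX x hx := by
    obtain ⟨t, -, ht⟩ := hE.conformalKilling.exists_conformalFactor
    refine hE.orthogonallyIntegrable.eq_of_mem_perp
      (g.normalPart_mem_perp (hE.orthogonallyIntegrable.nondegenerate i) _)
      (Submodule.zero_mem _) fun j hij z hz ↦ ?_
    have hZ := hE.isSectionOn_sectionThrough (⟨z, hz⟩ : E j x)
    have h := hE.inner_leviCivita_meanCurvature ht hi hij (hU.inter (isOpen_trivNhd x))
      (hX.mono Set.inter_subset_left) (hZ.mono Set.inter_subset_right) ⟨hx, mem_trivNhd x⟩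
    rw [hE.sectionThrough_self] at h
    rw [g.inner_normalPart_left (hE.orthogonallyIntegrable.le_perp hij x hz), h]
    simp

end Metric.IsConformalKillingNet

end PseudoRiemannian

theorem mainTheorem7
    {V : Type*} [NormedAddCommGroup V] [NormedSpace ℝ V] [FiniteDimensional ℝ V]
    {M : Type*} [TopologicalSpace M] [ChartedSpace V M] [IsManifold 𝓘(ℝ, V) ∞ M]
    (g : PseudoRiemannian.Metric V M) {k : ℕ}
    (T : Π x : M, TangentSpace 𝓘(ℝ, V) x →L[ℝ] TangentSpace 𝓘(ℝ, V) x)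
    (lam : Fin k → M → ℝ) (E : Fin k → PseudoRiemannian.Distribution V M)
    (hE : g.IsConformalKillingNet T lam E)
    (i : Fin k) (hi : g.IsGeodesic (g.perp (E i))) :
    g.IsSpherical (E i) ∧ g.IsKilling (E i) :=
  ⟨hE.isSpherical hi, hE.isSpherical hi, hi⟩
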